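/- Conventions. For a complex algebra $A$, not necessarily unital, $HH_n(A)$ ($n\ge 0$) is the $n$th homology group of the complex $(A^{\otimes (n+1)}, b)$, where $$b(a_0\otimes\cdots\otimes a_n)=\sum_{i=0}^{n-1}(-1)^i a_0\otimes\cdots\otimes a_ia_{i+1}\otimes\cdots\otimes a_n+(-1)^n a_na_0\otimes a_1\otimes\cdots\otimes a_{n-1}.$$ For a unital complex algebra $U$, the periodic cyclic homology $\mathrm{HP}_q^{\mathrm{un}}(U)$, $q\in\mathbb Z/2$, is the homology of the $\mathbb Z/2$-graded complex $\bigl(\prod_{n\equiv q} U^{\otimes(n+1)},\, b+B\bigr)$, where $B=(1-t)\,s\sum_{k=0}^n t^k$ on $U^{\otimes (n+1)}$, $s(a_0\otimes\cdots\otimes a_n)=1\otimes a_0\otimes\cdots\otimes a_n$ and $t(a_0\otimes\cdots\otimes a_n)=(-1)^na_n\otimes a_0\otimes\cdots\otimes a_{n-1}$. For an arbitrary complex algebra $A$, with $A^+=A\oplus\mathbb C$ the algebra with adjoined unit, $\mathrm{HP}_q(A)$ is the cokernel of $\mathrm{HP}_q^{\mathrm{un}}(\mathbb C)\to\mathrm{HP}_q^{\mathrm{un}}(A^+)$.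 Proposition. Let $B$ be a complex algebra, not necessarily unital, that is the (internal) direct sum $B=\bigoplus_{n\in\mathbb N}B_n$ of two-sided ideals $B_n\subset B$. Assume that $B=\bigcup_{k\in\mathbb N} e_kBe_k$ for a sequence of idempotents $e_k\in B$, and that there is an $N\in\mathbb N$ with $HH_q(B)=0$ for all $q>N$. Then, for every $q\in\mathbb Z/2$, the inclusions $B_n\subset B$ induce an isomorphism of complex vector spaces $$\bigoplus_{n\in\mathbb N}\mathrm{HP}_q(B_n)\;\xrightarrow{\ \cong\ }\;\mathrm{HP}_q(B).$$ -/

import Mathlib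

noncomputable section

open scoped TensorProduct DirectSum

namespace CyclicHomology

/-! ## Hochschild chains of a (not necessarily unital) algebra -/

section NonUnital

variable (R : Type*) [CommRing R] (A : Type*) [NonUnitalRing A] [Module R A]

/-- Hochschild `n`-chains of `A`: the tensor power `A ⊗ ⋯ ⊗ A` with `n + 1` factors. -/
abbrev Chain (n : ℕ) : Type _ := ⨂[R] _ : Fin (n + 1), A

/-- The signed cyclic operator
`t (a₀ ⊗ ⋯ ⊗ aₙ) = (-1)ⁿ aₙ ⊗ a₀ ⊗ ⋯ ⊗ aₙ₋₁`. -/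
def cyc (n : ℕ) : Chain R A n →ₗ[R] Chain R A n :=
  (-1 : R) ^ n • (PiTensorProduct.reindex R (fun _ => A) (finRotate (n + 1))).toLinearMap

variable {R A} in
lemma cyc_tprod (n : ℕ) (a : Fin (n + 1) → A) :
    cyc R A n (PiTensorProduct.tprod R a)
      = (-1 : R) ^ n • PiTensorProduct.tprod R (fun i => a ((finRotate (n + 1)).symm i)) := by
  simp [cyc, PiTensorProduct.reindex_tprod]

variable [IsScalarTower R A A] [SMulCommClass R A A]

variable {A} in
/-- Replacing one entry of a tuple `a` changes exactly one entry of the contracted tuple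
`(a₀, …, aⱼ aⱼ₊₁, …, aₙ₊₁)`, and it does so linearly. -/
lemma contractNth_update {n : ℕ} (j : Fin (n + 1)) (a : Fin (n + 2) → A) (k : Fin (n + 2)) :
    ∃ (p : Fin (n + 1)) (L : A →ₗ[R] A), ∀ x : A,
      Fin.contractNth j.castSucc (· * ·) (Function.update a k x)
        = Function.update (Fin.contractNth j.castSucc (· * ·) a) p (L x) := by
  rcases lt_trichotomy k j.castSucc with h | h | h
  · refine ⟨k.castPred (Fin.ne_last_of_lt h), LinearMap.id, fun x => funext fun i => ?_⟩
    simp only [Fin.contractNth, Function.update_apply, Fin.ext_iff, Fin.lt_def,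
      Fin.val_castSucc, Fin.val_succ, Fin.coe_castPred, LinearMap.id_apply] at h ⊢
    split_ifs <;> first | rfl | omega
  · refine ⟨j, LinearMap.mulRight R (a j.succ), fun x => funext fun i => ?_⟩
    subst h
    by_cases hi : i = j
    · subst hi
      simp [Fin.contractNth, Fin.ext_iff]
    · simp only [Fin.contractNth, Function.update_apply, Fin.ext_iff,
        Fin.val_castSucc, Fin.val_succ] at hi ⊢
      split_ifs <;> first | rfl | omega
  · by_cases h' : k = j.succ
    · refine ⟨j, LinearMap.mulLeft R (a j.castSucc), fun x => funext fun i => ?_⟩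
      subst h'
      by_cases hi : i = j
      · subst hi
        simp [Fin.contractNth, Fin.ext_iff]
      · simp only [Fin.contractNth, Function.update_apply, Fin.ext_iff,
          Fin.val_castSucc, Fin.val_succ] at hi ⊢
        split_ifs <;> first | rfl | omega
    · refine ⟨k.pred (Fin.ne_zero_of_lt h), LinearMap.id, fun x => funext fun i => ?_⟩
      simp only [Fin.contractNth, Function.update_apply, Fin.ext_iff, Fin.lt_def,
        Fin.val_castSucc, Fin.val_succ, Fin.val_pred, LinearMap.id_apply] at h h' ⊢
      split_ifs <;> first | rfl | omega

/-- The multilinear map `(a₀, …, aₙ₊₁) ↦ a₀ ⊗ ⋯ ⊗ aⱼ aⱼ₊₁ ⊗ ⋯ ⊗ aₙ₊₁`. -/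
def faceMultilinear (n : ℕ) (j : Fin (n + 1)) :
    MultilinearMap R (fun _ : Fin (n + 2) => A) (Chain R A n) :=
  MultilinearMap.mk'
    (fun a => PiTensorProduct.tprod R (Fin.contractNth j.castSucc (· * ·) a))
    (fun a k x y => by
      obtain ⟨p, L, h⟩ := contractNth_update R j a k
      simp only [h, map_add, MultilinearMap.map_update_add])
    (fun a k c x => by
      obtain ⟨p, L, h⟩ := contractNth_update R j a k
      simp only [h, map_smul, MultilinearMap.map_update_smul])

/-- The `j`-th inner face
`a₀ ⊗ ⋯ ⊗ aₙ₊₁ ↦ a₀ ⊗ ⋯ ⊗ aⱼ aⱼ₊₁ ⊗ ⋯ ⊗ aₙ₊₁`, for `0 ≤ j ≤ n`. -/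
def face (n : ℕ) (j : Fin (n + 1)) : Chain R A (n + 1) →ₗ[R] Chain R A n :=
  PiTensorProduct.lift (faceMultilinear R A n j)

variable {R A} in
lemma face_tprod (n : ℕ) (j : Fin (n + 1)) (a : Fin (n + 2) → A) :
    face R A n j (PiTensorProduct.tprod R a)
      = PiTensorProduct.tprod R (Fin.contractNth j.castSucc (· * ·) a) := by
  simp [face, faceMultilinear]

/-- The bar differential
`b' (a₀ ⊗ ⋯ ⊗ aₙ₊₁) = ∑_{j ≤ n} (-1)ʲ a₀ ⊗ ⋯ ⊗ aⱼ aⱼ₊₁ ⊗ ⋯ ⊗ aₙ₊₁`. -/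
def b' (n : ℕ) : Chain R A (n + 1) →ₗ[R] Chain R A n :=
  ∑ j : Fin (n + 1), (-1 : R) ^ (j : ℕ) • face R A n j

/-- The Hochschild differential
`b (a₀ ⊗ ⋯ ⊗ aₙ₊₁) = b' (a₀ ⊗ ⋯ ⊗ aₙ₊₁) + (-1)ⁿ⁺¹ aₙ₊₁ a₀ ⊗ a₁ ⊗ ⋯ ⊗ aₙ`.
The last summand is the `0`-th face of `t (a₀ ⊗ ⋯ ⊗ aₙ₊₁)`. -/
def b (n : ℕ) : Chain R A (n + 1) →ₗ[R] Chain R A n :=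
  b' R A n + face R A n 0 ∘ₗ cyc R A (n + 1)

/-- Hochschild cycles; the differential out of degree `0` is zero. -/
def hochschildCycles : (n : ℕ) → Submodule R (Chain R A n)
  | 0 => ⊤
  | n + 1 => LinearMap.ker (b R A n)

/-- Hochschild homology `HHₙ(A)`: the homology of the complex
`(A^{⊗ (n + 1)}, b)`, for an algebra not necessarily with unit. -/
abbrev HH (n : ℕ) : Type _ :=
  hochschildCycles R A n ⧸ (LinearMap.range (b R A n)).submoduleOf (hochschildCycles R A n)

end NonUnital

/-! ## The periodic cyclic complex of a unital algebra -/

section Unital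

variable (R : Type*) [CommRing R] (A : Type*) [Ring A] [Algebra R A]

/-- The operator `s (a₀ ⊗ ⋯ ⊗ aₙ) = 1 ⊗ a₀ ⊗ ⋯ ⊗ aₙ`. -/
def s (n : ℕ) : Chain R A n →ₗ[R] Chain R A (n + 1) :=
  PiTensorProduct.lift
    ((PiTensorProduct.tprod R : MultilinearMap R (fun _ : Fin (n + 2) => A) _).curryLeft 1)

variable {R A} in
lemma s_tprod (n : ℕ) (a : Fin (n + 1) → A) :
    s R A n (PiTensorProduct.tprod R a)
      = PiTensorProduct.tprod R (Fin.cons 1 a : Fin (n + 2) → A) := by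
  simp [s]

/-- The Connes operator `B = (1 - t) s ∑_{k = 0}^{n} tᵏ`. -/
def B (n : ℕ) : Chain R A n →ₗ[R] Chain R A (n + 1) :=
  (LinearMap.id - cyc R A (n + 1)) ∘ₗ s R A n ∘ₗ ∑ k ∈ Finset.range (n + 1), cyc R A n ^ k

/-- All periodic cyclic chains: (possibly infinite) sequences of Hochschild chains. -/
abbrev PerChain : Type _ := (n : ℕ) → Chain R A n

/-- The periodic cyclic differential `b + B`: the degree `m` component of `(b + B) ω` is
`b ωₘ₊₁ + B ωₘ₋₁`, with `ω₋₁ = 0`. -/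
def perD : PerChain R A →ₗ[R] PerChain R A :=
  LinearMap.pi fun m => match m with
    | 0 => b R A 0 ∘ₗ LinearMap.proj 1
    | m + 1 => b R A (m + 1) ∘ₗ LinearMap.proj (m + 2) + B R A m ∘ₗ LinearMap.proj m

/-- The periodic cyclic chains of degree `q ∈ ℤ/2`: sequences of Hochschild chains whose degrees
all have parity `q`. -/
def perGraded (q : ZMod 2) : Submodule R (PerChain R A) where
  carrier := {ω | ∀ n : ℕ, (n : ZMod 2) ≠ q → ω n = 0}
  add_mem' h₁ h₂ n hn := by simp [h₁ n hn, h₂ n hn]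
  zero_mem' _ _ := rfl
  smul_mem' c _ h n hn := by simp [h n hn]

/-- The periodic cyclic cycles of degree `q`. -/
def perCycles (q : ZMod 2) : Submodule R (PerChain R A) :=
  LinearMap.ker (perD R A) ⊓ perGraded R A q

/-- The periodic cyclic boundaries of degree `q`; note that `q - 1 = q + 1` in `ℤ/2`. -/
def perBoundaries (q : ZMod 2) : Submodule R (PerChain R A) :=
  (perGraded R A (q + 1)).map (perD R A)

/-- Periodic cyclic homology of a unital algebra: the homology in degree `q ∈ ℤ/2` of the periodic
cyclic complex. -/
abbrev HPUnital (q : ZMod 2) : Type _ :=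
  perCycles R A q ⧸ (perBoundaries R A q).submoduleOf (perCycles R A q)

end Unital

/-! ## Functoriality -/

section Functoriality

variable {R : Type*} [CommRing R]

section Unital

variable {A : Type*} [Ring A] [Algebra R A] {A' : Type*} [Ring A'] [Algebra R A']
  {A'' : Type*} [Ring A''] [Algebra R A'']

/-- The map `a₀ ⊗ ⋯ ⊗ aₙ ↦ f a₀ ⊗ ⋯ ⊗ f aₙ` on Hochschild chains. -/
def chainMap (f : A →ₐ[R] A') (n : ℕ) : Chain R A n →ₗ[R] Chain R A' n :=
  PiTensorProduct.map fun _ => f.toLinearMap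

lemma chainMap_tprod (f : A →ₐ[R] A') (n : ℕ) (a : Fin (n + 1) → A) :
    chainMap f n (PiTensorProduct.tprod R a) = PiTensorProduct.tprod R (f ∘ a) := by
  simp only [chainMap, PiTensorProduct.map_tprod]
  rfl

lemma chainMap_cyc (f : A →ₐ[R] A') (n : ℕ) (x : Chain R A n) :
    chainMap f n (cyc R A n x) = cyc R A' n (chainMap f n x) := by
  suffices h : chainMap f n ∘ₗ cyc R A n = cyc R A' n ∘ₗ chainMap f n from
    LinearMap.congr_fun h x
  refine PiTensorProduct.ext (MultilinearMap.ext fun a => ?_)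
  simp only [LinearMap.compMultilinearMap_apply, LinearMap.comp_apply, cyc_tprod,
    chainMap_tprod, map_smul]
  rfl

lemma chainMap_cyc_pow (f : A →ₐ[R] A') (n k : ℕ) (x : Chain R A n) :
    chainMap f n ((cyc R A n ^ k) x) = (cyc R A' n ^ k) (chainMap f n x) := by
  induction k with
  | zero => simp
  | succ k ih => simp only [pow_succ', Module.End.mul_apply, chainMap_cyc, ih]

lemma chainMap_face (f : A →ₐ[R] A') (n : ℕ) (j : Fin (n + 1)) (x : Chain R A (n + 1)) :
    chainMap f n (face R A n j x) = face R A' n j (chainMap f (n + 1) x) := by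
  suffices h : chainMap f n ∘ₗ face R A n j = face R A' n j ∘ₗ chainMap f (n + 1) from
    LinearMap.congr_fun h x
  refine PiTensorProduct.ext (MultilinearMap.ext fun a => ?_)
  simp only [LinearMap.compMultilinearMap_apply, LinearMap.comp_apply, face_tprod,
    chainMap_tprod]
  rw [Fin.comp_contractNth (· * ·) (· * ·) (map_mul f)]

lemma chainMap_b (f : A →ₐ[R] A') (n : ℕ) (x : Chain R A (n + 1)) :
    chainMap f n (b R A n x) = b R A' n (chainMap f (n + 1) x) := by
  simp only [b, b', LinearMap.add_apply, LinearMap.sum_apply, LinearMap.smul_apply,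
    LinearMap.comp_apply, map_add, map_sum, map_smul, chainMap_face, chainMap_cyc]

lemma chainMap_s (f : A →ₐ[R] A') (n : ℕ) (x : Chain R A n) :
    chainMap f (n + 1) (s R A n x) = s R A' n (chainMap f n x) := by
  suffices h : chainMap f (n + 1) ∘ₗ s R A n = s R A' n ∘ₗ chainMap f n from
    LinearMap.congr_fun h x
  refine PiTensorProduct.ext (MultilinearMap.ext fun a => ?_)
  simp only [LinearMap.compMultilinearMap_apply, LinearMap.comp_apply, s_tprod,
    chainMap_tprod]
  congr 1
  funext i
  refine Fin.cases ?_ (fun i => ?_) i <;> simp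

lemma chainMap_B (f : A →ₐ[R] A') (n : ℕ) (x : Chain R A n) :
    chainMap f (n + 1) (B R A n x) = B R A' n (chainMap f n x) := by
  simp only [B, LinearMap.comp_apply, LinearMap.sub_apply, LinearMap.id_apply, map_sub,
    LinearMap.sum_apply, map_sum, chainMap_cyc, chainMap_s, chainMap_cyc_pow]

/-- The map induced by an algebra homomorphism on periodic cyclic chains. -/
def perMap (f : A →ₐ[R] A') : PerChain R A →ₗ[R] PerChain R A' :=
  LinearMap.pi fun n => chainMap f n ∘ₗ LinearMap.proj n

lemma perMap_perD (f : A →ₐ[R] A') (ω : PerChain R A) :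
    perMap f (perD R A ω) = perD R A' (perMap f ω) := by
  funext m
  cases m with
  | zero => exact chainMap_b f 0 (ω 1)
  | succ m =>
    change chainMap f (m + 1) (b R A (m + 1) (ω (m + 2)) + B R A m (ω m)) = _
    rw [map_add, chainMap_b, chainMap_B]
    rfl

lemma perMap_perGraded (f : A →ₐ[R] A') (q : ZMod 2) {ω : PerChain R A}
    (h : ω ∈ perGraded R A q) : perMap f ω ∈ perGraded R A' q := fun n hn => by
  change chainMap f n (ω n) = 0
  rw [h n hn, map_zero]

lemma perMap_perCycles (f : A →ₐ[R] A') (q : ZMod 2) (ω : PerChain R A)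
    (h : ω ∈ perCycles R A q) : perMap f ω ∈ perCycles R A' q := by
  refine ⟨LinearMap.mem_ker.2 ?_, perMap_perGraded f q h.2⟩
  rw [← perMap_perD, LinearMap.mem_ker.1 h.1, map_zero]

lemma perMap_perBoundaries (f : A →ₐ[R] A') (q : ZMod 2) (ω : PerChain R A)
    (h : ω ∈ perBoundaries R A q) : perMap f ω ∈ perBoundaries R A' q := by
  obtain ⟨η, hη, rfl⟩ := h
  exact ⟨perMap f η, perMap_perGraded f _ hη, (perMap_perD f η).symm⟩

/-- The map `HP_q(A) → HP_q(A')` induced by a homomorphism of unital algebras. -/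
def HPUnital.map (f : A →ₐ[R] A') (q : ZMod 2) : HPUnital R A q →ₗ[R] HPUnital R A' q :=
  Submodule.mapQ _ _ ((perMap f).restrict (perMap_perCycles f q))
    fun ω hω => perMap_perBoundaries f q ω hω

lemma chainMap_comp (g : A' →ₐ[R] A'') (f : A →ₐ[R] A') (n : ℕ) (x : Chain R A n) :
    chainMap (g.comp f) n x = chainMap g n (chainMap f n x) := by
  suffices h : chainMap (g.comp f) n = chainMap g n ∘ₗ chainMap f n from
    LinearMap.congr_fun h x
  refine PiTensorProduct.ext (MultilinearMap.ext fun a => ?_)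
  simp only [LinearMap.compMultilinearMap_apply, LinearMap.comp_apply, chainMap_tprod]
  rfl

lemma HPUnital.map_comp (g : A' →ₐ[R] A'') (f : A →ₐ[R] A') (q : ZMod 2)
    (x : HPUnital R A q) :
    HPUnital.map (g.comp f) q x = HPUnital.map g q (HPUnital.map f q x) := by
  obtain ⟨ω, rfl⟩ := Submodule.Quotient.mk_surjective _ x
  refine congrArg Submodule.Quotient.mk (Subtype.ext (funext fun n => ?_))
  exact chainMap_comp g f n _

end Unital

section NonUnital

variable (R) (A : Type*) [NonUnitalRing A] [Module R A] [IsScalarTower R A A]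
  [SMulCommClass R A A]

/-- The image of `HP_q(R) → HP_q(A⁺)`, where `A⁺ = R ⊕ A` is the algebra with adjoined unit. -/
def HP.scalars (q : ZMod 2) : Submodule R (HPUnital R (Unitization R A) q) :=
  LinearMap.range (HPUnital.map (Algebra.ofId R (Unitization R A)) q)

/-- Periodic cyclic homology of an algebra `A`, not necessarily with unit: the cokernel of the map
`HP_q(R) → HP_q(A⁺)`. -/
def HP (q : ZMod 2) : Type _ := HPUnital R (Unitization R A) q ⧸ HP.scalars R A q

instance (q : ZMod 2) : AddCommGroup (HP R A q) :=
  inferInstanceAs (AddCommGroup (HPUnital R (Unitization R A) q ⧸ HP.scalars R A q))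

instance (q : ZMod 2) : Module R (HP R A q) :=
  inferInstanceAs (Module R (HPUnital R (Unitization R A) q ⧸ HP.scalars R A q))

variable {R A} {A' : Type*} [NonUnitalRing A'] [Module R A'] [IsScalarTower R A' A']
  [SMulCommClass R A' A']

/-- The unital homomorphism `f⁺ : A⁺ → A'⁺` extending a homomorphism `f : A → A'`. -/
def unitizationMap (f : A →ₙₐ[R] A') : Unitization R A →ₐ[R] Unitization R A' :=
  Unitization.lift ((Unitization.inrNonUnitalAlgHom R A').comp f)

/-- The map `HP_q(A) → HP_q(A')` induced by a homomorphism of (non-unital) algebras. -/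
def HP.map (f : A →ₙₐ[R] A') (q : ZMod 2) : HP R A q →ₗ[R] HP R A' q :=
  Submodule.mapQ (HP.scalars R A q) (HP.scalars R A' q) (HPUnital.map (unitizationMap f) q) <| by
    rintro _ ⟨x, rfl⟩
    refine ⟨x, ?_⟩
    rw [← HPUnital.map_comp]
    exact congrArg (fun g : R →ₐ[R] Unitization R A' => HPUnital.map g q x) (Subsingleton.elim _ _)

end NonUnital

end Functoriality

/-- A subalgebra `I` of a (not necessarily unital) algebra is a two-sided ideal. -/
def IsTwoSidedIdeal {R A : Type*} [CommRing R] [NonUnitalRing A] [Module R A]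
    (I : NonUnitalSubalgebra R A) : Prop :=
  ∀ a : A, ∀ x ∈ I, a * x ∈ I ∧ x * a ∈ I

end CyclicHomology

end

/-!
# Periodic cyclic homology of a direct sum of ideals

Injectivity is formal: the projections `pᵢ : B → Bᵢ` are algebra homomorphisms, so they detect the
components of an element of `⨁ HP_q(Bᵢ)` in its image in `HP_q(B)` (`HP.fromSum_injective`).

For surjectivity, note first that every finite subset of `B` is fixed on both sides by a single
`e = e_k` (`exists_idempotent_fixing`): a finite-dimensional complex vector space is not a countable
union of proper subspaces, by Baire's theorem. The components `eᵢ = pᵢ e` are idempotents of `B⁺`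
which, together with `1 - e`, have sum `1`; they commute with all entries of a given chain, once `e`
fixes these entries. For a sum of such idempotents `c`, an explicit simplicial homotopy moves a
Hochschild cycle, within its homology class, to the sum of its images under
`a₀ ⊗ ⋯ ⊗ aₙ ↦ c a₀ ⊗ ⋯ ⊗ c aₙ` (`b_homotopy_of_mem_cycles`, `sum_mulHead`). For `c = eᵢ` the image
is a cycle of `Bᵢ`, and for `c = 1 - e` it vanishes if the augmentation `B⁺ → ℂ` kills the chain.
Hence each Hochschild cycle of `B⁺` in the kernel `K` of the augmentation is homologous to a finite
sum of cycles of the algebras `Bᵢ` (`exists_eq_b_add_sum`). In particular, `K` is acyclic above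
degree `N`, because `HH_n(B) = 0` there (`exists_b_eq_of_subsingleton_HH`).

Now take a class in `HP_q(B)`, represented by a periodic cycle `ω = (ωₙ)` in `K`. By the previous
paragraph, its lowest component `ωₙ` can be removed by subtracting from `ω` finitely many of the
cycles `pᵢ ω`, which represent classes coming from `HP_q(Bᵢ)`, and a boundary. After finitely many
such steps, `ω` has no components of degree at most `N` (`HP.exists_cycle_vanishing_below`). Then
`(b + B) η = ω` can be solved degree by degree (`mem_perBoundaries_of_acyclic`); this is possible
because periodic chains are infinite sequences. The identities `b² = B² = b B + B b = 0` used on the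
way are derived from the relations between the faces and the cyclic operator `t`.
-/

noncomputable section

open scoped TensorProduct DirectSum

namespace CyclicHomology

/-! ### Pure tensors, faces and the cyclic operator -/

section Sequences

variable {R : Type*} [CommRing R] {A : Type*} [NonUnitalRing A] [Module R A]
  {A' : Type*} [NonUnitalRing A'] [Module R A'] {A'' : Type*} [NonUnitalRing A''] [Module R A'']

variable (R) in
/-- The pure tensor `a₀ ⊗ ⋯ ⊗ aₙ` of the first `n + 1` terms of a sequence. Indexing tuples by `ℕ`
instead of `Fin (n + 1)` turns identities between operations on tuples into case distinctions
between natural numbers. -/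
def pureChain (n : ℕ) (a : ℕ → A) : Chain R A n := PiTensorProduct.tprod R fun i => a i

lemma pureChain_congr {n : ℕ} {a a' : ℕ → A} (h : ∀ k ≤ n, a k = a' k) :
    pureChain R n a = pureChain R n a' :=
  congrArg (PiTensorProduct.tprod R) (funext fun i : Fin (n + 1) => h i (Nat.lt_succ_iff.1 i.2))

lemma tprod_eq_pureChain (n : ℕ) (a : Fin (n + 1) → A) :
    PiTensorProduct.tprod R a = pureChain R n fun k => a (Fin.ofNat (n + 1) k) := by
  refine congrArg _ (funext fun i => ?_)
  simp

lemma chain_hom_ext {n : ℕ} {M : Type*} [AddCommGroup M] [Module R M] {f g : Chain R A n →ₗ[R] M}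
    (h : ∀ a, f (pureChain R n a) = g (pureChain R n a)) : f = g :=
  PiTensorProduct.ext <| MultilinearMap.ext fun a => by
    simpa only [LinearMap.compMultilinearMap_apply, tprod_eq_pureChain] using h _

variable (R) in
/-- The chains spanned by the pure tensors all of whose entries lie in `S`. -/
def spanChain (S : Set A) (n : ℕ) : Submodule R (Chain R A n) :=
  Submodule.span R (pureChain R n '' {a | ∀ k, a k ∈ S})

lemma spanChain_mono {S T : Set A} (h : S ⊆ T) (n : ℕ) : spanChain R S n ≤ spanChain R T n :=
  Submodule.span_mono (Set.image_mono fun _ ha k => h (ha k))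

lemma exists_mem_spanChain (n : ℕ) (x : Chain R A n) :
    ∃ S : Set A, S.Finite ∧ x ∈ spanChain R S n := by
  induction x using PiTensorProduct.induction_on with
  | smul_tprod r a =>
    refine ⟨Set.range a, Set.finite_range a, Submodule.smul_mem _ _ (Submodule.subset_span ?_)⟩
    exact ⟨_, fun k => Set.mem_range_self _, (tprod_eq_pureChain n a).symm⟩
  | add x y hx hy =>
    obtain ⟨S, hS, hx⟩ := hx
    obtain ⟨T, hT, hy⟩ := hy
    exact ⟨S ∪ T, hS.union hT, add_mem (spanChain_mono Set.subset_union_left n hx)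
      (spanChain_mono Set.subset_union_right n hy)⟩

lemma mem_spanChain_univ (n : ℕ) (x : Chain R A n) : x ∈ spanChain R Set.univ n :=
  have ⟨_, _, h⟩ := exists_mem_spanChain n x
  spanChain_mono (Set.subset_univ _) n h

/-- The map `a₀ ⊗ ⋯ ⊗ aₙ ↦ E a₀ ⊗ ⋯ ⊗ E aₙ`. -/
def mapChain (E : A →ₗ[R] A') (n : ℕ) : Chain R A n →ₗ[R] Chain R A' n :=
  PiTensorProduct.map fun _ => E

lemma mapChain_pureChain (E : A →ₗ[R] A') (n : ℕ) (a : ℕ → A) :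
    mapChain E n (pureChain R n a) = pureChain R n fun k => E (a k) :=
  PiTensorProduct.map_tprod _ _

lemma mapChain_comp (E : A' →ₗ[R] A'') (E' : A →ₗ[R] A') (n : ℕ) (x : Chain R A n) :
    mapChain (E ∘ₗ E') n x = mapChain E n (mapChain E' n x) :=
  LinearMap.congr_fun (PiTensorProduct.map_comp (fun _ => E) fun _ => E') x

lemma mapChain_id (n : ℕ) (x : Chain R A n) : mapChain LinearMap.id n x = x :=
  LinearMap.congr_fun PiTensorProduct.map_id x

lemma mapChain_zero (n : ℕ) (x : Chain R A n) : mapChain (0 : A →ₗ[R] A') n x = 0 := by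
  suffices h : mapChain (0 : A →ₗ[R] A') n = 0 by rw [h, LinearMap.zero_apply]
  refine chain_hom_ext fun a => ?_
  rw [mapChain_pureChain]
  exact MultilinearMap.map_coord_zero _ 0 rfl

/-- The sequence `(a₀, …, aⱼ aⱼ₊₁, aⱼ₊₂, …)`. -/
def contract (j : ℕ) (a : ℕ → A) : ℕ → A := fun k =>
  if k < j then a k else if k = j then a k * a (k + 1) else a (k + 1)

/-- The sequence `(aₙ, a₀, …, aₙ₋₁, …)`. -/
def rotate (n : ℕ) (a : ℕ → A) : ℕ → A := fun k => if k = 0 then a n else a (k - 1)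

lemma cyc_pureChain (n : ℕ) (a : ℕ → A) :
    cyc R A n (pureChain R n a) = (-1 : R) ^ n • pureChain R n (rotate n a) := by
  rw [pureChain, cyc_tprod]
  congr 2
  funext i
  refine Fin.cases ?_ (fun i => ?_) i
  · have : (finRotate (n + 1)).symm 0 = Fin.last n := by
      rw [Equiv.symm_apply_eq, finRotate_last]
    simp [rotate, this]
  · have : (finRotate (n + 1)).symm i.succ = i.castSucc := by
      rw [Equiv.symm_apply_eq, finRotate_apply, Fin.coeSucc_eq_succ]
    simp [rotate, this]

omit [NonUnitalRing A] in
lemma iterate_rotate_apply (n : ℕ) (a : ℕ → A) (k m : ℕ) (hk : k ≤ n + 1) (hm : m ≤ n) :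
    (rotate n)^[k] a m = if m < k then a (m + n + 1 - k) else a (m - k) := by
  induction k generalizing m with
  | zero => simp
  | succ k ih =>
    rw [Function.iterate_succ_apply', rotate]
    rcases m with - | m
    · rw [if_pos rfl, ih n (by omega) le_rfl]
      split_ifs <;> first | omega | (congr 1; omega)
    · rw [if_neg (by omega), Nat.add_sub_cancel, ih m (by omega) (by omega)]
      split_ifs <;> first | omega | (congr 1; omega)

lemma cyc_pow_pureChain (n k : ℕ) (a : ℕ → A) :
    (cyc R A n ^ k) (pureChain R n a)
      = (-1 : R) ^ (n * k) • pureChain R n ((rotate n)^[k] a) := by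
  induction k with
  | zero => simp
  | succ k ih =>
    rw [pow_succ', Module.End.mul_apply, ih, map_smul, cyc_pureChain, smul_smul, ← pow_add,
      Function.iterate_succ_apply', Nat.mul_succ]

variable (R A) in
lemma cyc_pow_card (n : ℕ) : cyc R A n ^ (n + 1) = 1 := by
  refine chain_hom_ext fun a => ?_
  rw [cyc_pow_pureChain, (Nat.even_mul_succ_self n).neg_one_pow, one_smul, Module.End.one_apply]
  refine pureChain_congr fun k hk => ?_
  rw [iterate_rotate_apply n a _ _ le_rfl hk, if_pos (by omega)]
  congr 1
  omega

variable [IsScalarTower R A A] [SMulCommClass R A A]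

lemma face_pureChain (n : ℕ) (j : Fin (n + 1)) (a : ℕ → A) :
    face R A n j (pureChain R (n + 1) a) = pureChain R n (contract j a) := by
  rw [pureChain, face_tprod]
  refine congrArg _ (funext fun i => ?_)
  simp [Fin.contractNth, contract]

variable (R A) in
/-- The signed inner face `(-1)ʲ dⱼ`, for `j ≤ n`. The index is a natural number, so that relations
which shift it need no casts; for `j > n` it is reduced modulo `n + 1`, a value without meaning. -/
def signedFace (n j : ℕ) : Chain R A (n + 1) →ₗ[R] Chain R A n :=
  (-1 : R) ^ j • face R A n (Fin.ofNat (n + 1) j)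

lemma signedFace_pureChain {n j : ℕ} (hj : j ≤ n) (a : ℕ → A) :
    signedFace R A n j (pureChain R (n + 1) a)
      = (-1 : R) ^ j • pureChain R n (contract j a) := by
  rw [signedFace, LinearMap.smul_apply, face_pureChain, Fin.val_ofNat,
    Nat.mod_eq_of_lt (Nat.lt_succ_iff.2 hj)]

variable (R A) in
lemma b'_eq_sum (n : ℕ) : b' R A n = ∑ j ∈ Finset.range (n + 1), signedFace R A n j := by
  rw [Finset.sum_range, b']
  simp [signedFace]

variable (R A) in
lemma b_eq (n : ℕ) : b R A n = b' R A n + signedFace R A n 0 ∘ₗ cyc R A (n + 1) := by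
  simp [signedFace, b]

/-- The sequence underlying the `j`-th face of a pure Hochschild `(n + 1)`-chain. The last face
`(aₙ₊₁ a₀, a₁, …, aₙ)` is included as `j = n + 1`. -/
def cyclicFace (n j : ℕ) (a : ℕ → A) : ℕ → A :=
  if j = n + 1 then contract 0 (rotate (n + 1) a) else contract j a

lemma b_pureChain (n : ℕ) (a : ℕ → A) :
    b R A n (pureChain R (n + 1) a)
      = ∑ j ∈ Finset.range (n + 2), (-1 : R) ^ j • pureChain R n (cyclicFace n j a) := by
  rw [b_eq, b'_eq_sum, Finset.sum_range_succ _ (n + 1), LinearMap.add_apply, LinearMap.sum_apply,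
    LinearMap.comp_apply, cyc_pureChain, map_smul, signedFace_pureChain n.zero_le, pow_zero,
    one_smul, cyclicFace, if_pos rfl]
  refine congrArg (· + _) (Finset.sum_congr rfl fun j hj => ?_)
  have hj := Finset.mem_range.1 hj
  rw [signedFace_pureChain (Nat.lt_succ_iff.1 hj), cyclicFace, if_neg hj.ne]

/-- A linear map `E` commutes with `b` on the chains with entries in `S`, as soon as it is
multiplicative on `S`. -/
lemma b_mapChain [IsScalarTower R A' A'] [SMulCommClass R A' A'] (E : A →ₗ[R] A') {S : Set A}
    (hE : ∀ u ∈ S, ∀ v ∈ S, E (u * v) = E u * E v) {n : ℕ} {x : Chain R A (n + 1)}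
    (hx : x ∈ spanChain R S (n + 1)) :
    b R A' n (mapChain E (n + 1) x) = mapChain E n (b R A n x) := by
  refine LinearMap.eqOn_span (f := b R A' n ∘ₗ mapChain E (n + 1))
    (g := mapChain E n ∘ₗ b R A n) ?_ hx
  rintro _ ⟨a, ha, rfl⟩
  simp only [LinearMap.comp_apply, mapChain_pureChain, b_pureChain, map_sum, map_smul]
  refine Finset.sum_congr rfl fun j _ => congrArg _ (pureChain_congr fun k _ => ?_)
  have h : ∀ (j : ℕ) (a : ℕ → A), (∀ k, a k ∈ S) →
      contract j (fun k => E (a k)) k = E (contract j a k) := fun j a ha => by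
    simp only [contract]
    split_ifs <;> first | rfl | exact (hE _ (ha _) _ (ha _)).symm
  have hrot : rotate (n + 1) (fun k => E (a k)) = fun k => E (rotate (n + 1) a k) :=
    funext fun k => by simp only [rotate]; split_ifs <;> rfl
  have hrot' : ∀ k, rotate (n + 1) a k ∈ S := fun k => by
    simp only [rotate]; split_ifs <;> exact ha _
  simp only [cyclicFace]
  split_ifs
  · rw [hrot, h 0 _ hrot']
  · exact h j a ha

lemma mapChain_mem_hochschildCycles [IsScalarTower R A' A'] [SMulCommClass R A' A']
    (E : A →ₗ[R] A') {S : Set A} (hE : ∀ u ∈ S, ∀ v ∈ S, E (u * v) = E u * E v) {n : ℕ}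
    {x : Chain R A n} (hx : x ∈ spanChain R S n) (hx' : x ∈ hochschildCycles R A n) :
    mapChain E n x ∈ hochschildCycles R A' n := by
  rcases n with - | n
  · exact Submodule.mem_top
  · refine LinearMap.mem_ker.2 ?_
    rw [b_mapChain E hE hx, LinearMap.mem_ker.1 hx', map_zero]

/-- The relation `Dⱼ₊₁ t = t Dⱼ` for the signed faces `Dⱼ = (-1)ʲ dⱼ`. -/
lemma signedFace_succ_cyc {n j : ℕ} (hj : j < n) (x : Chain R A (n + 1)) :
    signedFace R A n (j + 1) (cyc R A (n + 1) x) = cyc R A n (signedFace R A n j x) := by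
  suffices h : signedFace R A n (j + 1) ∘ₗ cyc R A (n + 1) = cyc R A n ∘ₗ signedFace R A n j from
    LinearMap.congr_fun h x
  refine chain_hom_ext fun a => ?_
  simp only [LinearMap.comp_apply, cyc_pureChain, map_smul, signedFace_pureChain hj,
    signedFace_pureChain hj.le, smul_smul, ← pow_add]
  rw [show n + 1 + (j + 1) = j + n + 2 by ring, pow_add _ _ 2, neg_one_sq, mul_one]
  congr 1
  refine pureChain_congr fun k hk => ?_
  rcases k with - | k <;> simp only [contract, rotate] <;> split_ifs <;>
    first | rfl | omega | contradiction

/-- The last face, written as `d₀ t`, satisfies the same relation with `t` as the inner ones. -/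
lemma signedFace_zero_cyc_cyc (n : ℕ) (x : Chain R A (n + 1)) :
    signedFace R A n 0 (cyc R A (n + 1) (cyc R A (n + 1) x))
      = cyc R A n (signedFace R A n n x) := by
  suffices h : signedFace R A n 0 ∘ₗ cyc R A (n + 1) ∘ₗ cyc R A (n + 1)
      = cyc R A n ∘ₗ signedFace R A n n from LinearMap.congr_fun h x
  refine chain_hom_ext fun a => ?_
  simp only [LinearMap.comp_apply, cyc_pureChain, map_smul, signedFace_pureChain n.zero_le,
    signedFace_pureChain le_rfl, smul_smul, ← pow_add]
  congr 1
  · rw [add_zero, ← two_mul, ← two_mul, pow_mul, pow_mul, neg_one_sq, one_pow, one_pow]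
  refine pureChain_congr fun k hk => ?_
  rcases k with - | k <;> simp only [contract, rotate] <;> split_ifs <;>
    first | rfl | omega | contradiction

/-- The simplicial identities for the inner faces, with signs. -/
lemma signedFace_signedFace {n i j : ℕ} (hij : i ≤ j) (hj : j ≤ n) (x : Chain R A (n + 2)) :
    signedFace R A n i (signedFace R A (n + 1) (j + 1) x)
      = -signedFace R A n j (signedFace R A (n + 1) i x) := by
  suffices h : signedFace R A n i ∘ₗ signedFace R A (n + 1) (j + 1)
      = -(signedFace R A n j ∘ₗ signedFace R A (n + 1) i) from LinearMap.congr_fun h x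
  refine chain_hom_ext fun a => ?_
  simp only [LinearMap.comp_apply, LinearMap.neg_apply, map_smul,
    signedFace_pureChain (show j + 1 ≤ n + 1 by omega),
    signedFace_pureChain (show i ≤ n + 1 by omega), signedFace_pureChain hj,
    signedFace_pureChain (hij.trans hj), smul_smul, ← pow_add, ← neg_smul]
  congr 1
  · rw [add_right_comm, pow_succ, add_comm j i, mul_neg_one, add_comm]
  refine pureChain_congr fun k hk => ?_
  simp only [contract]
  split_ifs <;> first | rfl | omega | skip
  all_goals subst_vars
  all_goals first | rfl | omega | exact (mul_assoc _ _ _).symm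


end Sequences

/-! ### The identities for `b`, `b'` and the norm operator -/

section CyclicIdentities

variable (R : Type*) [CommRing R] (A : Type*) [NonUnitalRing A] [Module R A]

/-- The norm operator `∑_{k ≤ n} tᵏ` on Hochschild `n`-chains. -/
def norm (n : ℕ) : Module.End R (Chain R A n) := ∑ k ∈ Finset.range (n + 1), cyc R A n ^ k

lemma one_sub_cyc_mul_norm (n : ℕ) : (1 - cyc R A n) * norm R A n = 0 := by
  rw [norm, mul_neg_geom_sum, cyc_pow_card, sub_self]

lemma norm_mul_one_sub_cyc (n : ℕ) : norm R A n * (1 - cyc R A n) = 0 := by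
  rw [norm, geom_sum_mul_neg, cyc_pow_card, sub_self]

lemma norm_mul_cyc_pow (n k : ℕ) : norm R A n * cyc R A n ^ k = norm R A n := by
  have h : norm R A n * cyc R A n = norm R A n := by
    have := norm_mul_one_sub_cyc R A n
    rwa [mul_sub, mul_one, sub_eq_zero, eq_comm] at this
  induction k with
  | zero => simp
  | succ k ih => rw [pow_succ, ← mul_assoc, ih, h]

lemma cyc_pow_mul_norm (n k : ℕ) : cyc R A n ^ k * norm R A n = norm R A n := by
  have h : cyc R A n * norm R A n = norm R A n := by
    have := one_sub_cyc_mul_norm R A n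
    rwa [sub_mul, one_mul, sub_eq_zero, eq_comm] at this
  induction k with
  | zero => simp
  | succ k ih => rw [pow_succ, mul_assoc, h, ih]

variable {R A} in
/-- The cancellation behind `b' b' = 0`. -/
lemma sum_sum_eq_zero_of_antisymm {G : Type*} [AddCommGroup G] (X : ℕ → ℕ → G) (m : ℕ)
    (h : ∀ i j, i ≤ j → j < m → X i (j + 1) = -X j i) :
    ∑ i ∈ Finset.range m, ∑ j ∈ Finset.range (m + 1), X i j = 0 := by
  induction m with
  | zero => simp
  | succ m ih =>
    have h₁ : ∑ i ∈ Finset.range m, X i (m + 1) = -∑ i ∈ Finset.range m, X m i := by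
      rw [← Finset.sum_neg_distrib]
      exact Finset.sum_congr rfl fun i hi => h i m (Finset.mem_range.1 hi).le m.lt_succ_self
    rw [Finset.sum_range_succ]
    simp only [Finset.sum_range_succ _ (m + 1)]
    rw [Finset.sum_add_distrib, ih fun i j hij hj => h i j hij (by omega), h₁,
      h m m le_rfl m.lt_succ_self, Finset.sum_range_succ]
    abel

variable {R A} [IsScalarTower R A A] [SMulCommClass R A A]

lemma b'_b' (n : ℕ) (x : Chain R A (n + 2)) : b' R A n (b' R A (n + 1) x) = 0 := by
  simp only [b'_eq_sum, LinearMap.sum_apply, map_sum]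
  rw [Finset.sum_comm]
  exact sum_sum_eq_zero_of_antisymm (fun i j => signedFace R A n i (signedFace R A (n + 1) j x))
    (n + 1) fun i j hij hj => signedFace_signedFace hij (Nat.lt_succ_iff.1 hj) x

lemma b_apply (n : ℕ) (x : Chain R A (n + 1)) :
    b R A n x = b' R A n x + signedFace R A n 0 (cyc R A (n + 1) x) := by
  rw [b_eq]; rfl

/-- All faces of `t x` but the `0`-th one are images under `t` of faces of `x`. -/
lemma b'_cyc (n : ℕ) (x : Chain R A (n + 1)) :
    b' R A n (cyc R A (n + 1) x) = signedFace R A n 0 (cyc R A (n + 1) x)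
      + cyc R A n (b' R A n x) - cyc R A n (signedFace R A n n x) := by
  simp only [b'_eq_sum, LinearMap.sum_apply, map_sum]
  rw [Finset.sum_range_succ', Finset.sum_range_succ, Finset.sum_congr rfl fun j hj =>
    signedFace_succ_cyc (Finset.mem_range.1 hj) x]
  abel

/-- The relation `b (1 - t) = (1 - t) b'`. -/
lemma b_sub_b_cyc (n : ℕ) (x : Chain R A (n + 1)) :
    b R A n x - b R A n (cyc R A (n + 1) x) = b' R A n x - cyc R A n (b' R A n x) := by
  rw [b_apply, b_apply, b'_cyc, signedFace_zero_cyc_cyc]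
  abel

/-- Since the last face is `d₀ t`, the relation `b² = 0` follows from `b'² = 0` and the relations
between `t` and the inner faces. -/
lemma b_b (n : ℕ) (x : Chain R A (n + 2)) : b R A n (b R A (n + 1) x) = 0 := by
  have h₁ : ∀ i ≤ n, signedFace R A n i (signedFace R A (n + 1) 0 (cyc R A (n + 2) x))
      = -signedFace R A n 0 (cyc R A (n + 1) (signedFace R A (n + 1) i x)) := fun i hi => by
    rw [← signedFace_succ_cyc (Nat.lt_succ_iff.2 hi), signedFace_signedFace (Nat.zero_le i) hi,
      neg_neg]
  have h₂ : signedFace R A n 0 (cyc R A (n + 1) (signedFace R A (n + 1) 0 (cyc R A (n + 2) x)))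
      = -signedFace R A n 0 (cyc R A (n + 1) (signedFace R A (n + 1) (n + 1) x)) := by
    rw [← signedFace_succ_cyc (Nat.succ_pos n), signedFace_signedFace le_rfl (Nat.zero_le n),
      signedFace_zero_cyc_cyc]
  rw [b_apply (n + 1), map_add, b_apply, b_apply, b'_b', h₂]
  simp only [b'_eq_sum, LinearMap.sum_apply, map_sum]
  rw [Finset.sum_congr rfl fun i hi => h₁ i (Nat.lt_succ_iff.1 (Finset.mem_range.1 hi)),
    Finset.sum_range_succ _ (n + 1), Finset.sum_neg_distrib]
  abel

lemma signedFace_cyc_pow {n j : ℕ} (hj : j ≤ n) (x : Chain R A (n + 1)) :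
    signedFace R A n j ((cyc R A (n + 1) ^ j) x) = (cyc R A n ^ j) (signedFace R A n 0 x) := by
  induction j with
  | zero => simp
  | succ j ih =>
    rw [pow_succ', Module.End.mul_apply, signedFace_succ_cyc hj, ih (by omega), pow_succ',
      Module.End.mul_apply]

/-- Both `b' ∑ tᵏ` and `(∑ tᵏ) b` are equal to `(∑ tᵏ) d₀ (∑ tᵏ)`. -/
lemma b'_norm (n : ℕ) (x : Chain R A (n + 1)) :
    b' R A n (norm R A (n + 1) x) = norm R A n (b R A n x) := by
  -- by `Dⱼ tʲ = tʲ D₀`, each summand of `b'` becomes a rotation of `D₀` next to the norm operator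
  have h₁ : ∀ j ≤ n, signedFace R A n j (norm R A (n + 1) x)
      = (cyc R A n ^ j) (signedFace R A n 0 (norm R A (n + 1) x)) := fun j hj => by
    rw [← signedFace_cyc_pow hj, ← Module.End.mul_apply, cyc_pow_mul_norm]
  have h₂ : ∀ j ≤ n, norm R A n (signedFace R A n j x)
      = norm R A n (signedFace R A n 0 ((cyc R A (n + 1) ^ (n + 2 - j)) x)) := fun j hj => by
    conv_rhs => rw [← norm_mul_cyc_pow R A n j, Module.End.mul_apply, ← signedFace_cyc_pow hj,
      ← Module.End.mul_apply (cyc R A (n + 1) ^ j), ← pow_add,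
      show j + (n + 2 - j) = n + 2 by omega,
      cyc_pow_card, Module.End.one_apply]
  have h₃ : norm R A n (b R A n x)
      = norm R A n (signedFace R A n 0 (norm R A (n + 1) x)) := by
    rw [b_apply, b'_eq_sum, LinearMap.sum_apply, map_add, map_sum,
      Finset.sum_congr rfl fun j hj => h₂ j (Nat.lt_succ_iff.1 (Finset.mem_range.1 hj))]
    have h₄ : norm R A (n + 1) x
        = ∑ k ∈ Finset.range (n + 2), (cyc R A (n + 1) ^ (n + 2 - k)) x := by
      rw [← norm_mul_cyc_pow R A (n + 1) 1, norm, Finset.sum_mul, LinearMap.sum_apply,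
        ← Finset.sum_range_reflect]
      refine Finset.sum_congr rfl fun k hk => ?_
      rw [← pow_add]
      have := Finset.mem_range.1 hk
      congr 2
      omega
    -- the summand `k = n + 1`, which is `t x`, accounts for the last face
    rw [h₄, Finset.sum_range_succ _ (n + 1), map_add, map_add, map_sum, map_sum,
      show n + 2 - (n + 1) = 1 by omega, pow_one]
  rw [h₃, b'_eq_sum, LinearMap.sum_apply, norm.eq_def R A n, LinearMap.sum_apply]
  exact Finset.sum_congr rfl fun j hj => h₁ j (Nat.lt_succ_iff.1 (Finset.mem_range.1 hj))

end CyclicIdentities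

/-! ### The mixed complex of a unital algebra -/

section MixedComplex

variable {R : Type*} [CommRing R] {A : Type*} [Ring A] [Algebra R A]

lemma s_pureChain (n : ℕ) (a : ℕ → A) :
    s R A n (pureChain R n a) = pureChain R (n + 1) fun k => if k = 0 then 1 else a (k - 1) := by
  rw [pureChain, s_tprod]
  refine congrArg (PiTensorProduct.tprod R) (funext fun i => ?_)
  refine Fin.cases ?_ (fun i => ?_) i <;> simp

lemma signedFace_zero_s (n : ℕ) (x : Chain R A n) : signedFace R A n 0 (s R A n x) = x := by
  suffices h : signedFace R A n 0 ∘ₗ s R A n = LinearMap.id from LinearMap.congr_fun h x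
  refine chain_hom_ext fun a => ?_
  rw [LinearMap.comp_apply, s_pureChain, signedFace_pureChain n.zero_le, pow_zero, one_smul]
  refine pureChain_congr fun k _ => ?_
  rcases k with - | k <;> simp [contract]

lemma signedFace_succ_s {n j : ℕ} (hj : j ≤ n) (x : Chain R A (n + 1)) :
    signedFace R A (n + 1) (j + 1) (s R A (n + 1) x) = -s R A n (signedFace R A n j x) := by
  suffices h : signedFace R A (n + 1) (j + 1) ∘ₗ s R A (n + 1)
      = -(s R A n ∘ₗ signedFace R A n j) from LinearMap.congr_fun h x
  refine chain_hom_ext fun a => ?_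
  simp only [LinearMap.comp_apply, LinearMap.neg_apply, s_pureChain,
    signedFace_pureChain (show j + 1 ≤ n + 1 by omega), signedFace_pureChain hj, map_smul]
  rw [pow_succ, mul_neg_one, neg_smul]
  congr 2
  refine pureChain_congr fun k _ => ?_
  rcases k with - | k <;> simp [contract]

/-- The bar complex of a unital algebra is contracted by `s`. -/
lemma b'_s (n : ℕ) (x : Chain R A (n + 1)) :
    b' R A (n + 1) (s R A (n + 1) x) = x - s R A n (b' R A n x) := by
  rw [b'_eq_sum, b'_eq_sum, LinearMap.sum_apply, LinearMap.sum_apply, Finset.sum_range_succ',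
    signedFace_zero_s, map_sum, Finset.sum_congr rfl fun j hj =>
      signedFace_succ_s (Nat.lt_succ_iff.1 (Finset.mem_range.1 hj)) x, Finset.sum_neg_distrib]
  abel

lemma b'_s_zero (x : Chain R A 0) : b' R A 0 (s R A 0 x) = x := by
  rw [b'_eq_sum, Finset.sum_range_one, signedFace_zero_s]

lemma B_apply (n : ℕ) (x : Chain R A n) :
    B R A n x = s R A n (norm R A n x) - cyc R A (n + 1) (s R A n (norm R A n x)) := rfl

lemma B_B (n : ℕ) (x : Chain R A n) : B R A (n + 1) (B R A n x) = 0 := by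
  have h : norm R A (n + 1) (B R A n x) = 0 :=
    LinearMap.congr_fun (norm_mul_one_sub_cyc R A (n + 1)) (s R A n (norm R A n x))
  rw [B_apply, h, map_zero, map_zero, sub_zero]

lemma b_B_zero (x : Chain R A 0) : b R A 0 (B R A 0 x) = 0 := by
  rw [B_apply, map_sub, b_sub_b_cyc, b'_s_zero]
  exact LinearMap.congr_fun (one_sub_cyc_mul_norm R A 0) x

/-- Let `N` be the norm operator. By the relations above,
`b (1 - t) s N = (1 - t) b' s N = (1 - t) (1 - s b') N = -(1 - t) s N b`. -/
lemma b_B_succ (n : ℕ) (x : Chain R A (n + 1)) :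
    b R A (n + 1) (B R A (n + 1) x) = -B R A n (b R A n x) := by
  have h : norm R A (n + 1) x - cyc R A (n + 1) (norm R A (n + 1) x) = 0 :=
    LinearMap.congr_fun (one_sub_cyc_mul_norm R A (n + 1)) x
  rw [B_apply, map_sub, b_sub_b_cyc, b'_s, b'_norm, B_apply, map_sub, sub_sub_sub_comm, h]
  abel

lemma perD_zero (ω : PerChain R A) : perD R A ω 0 = b R A 0 (ω 1) := rfl

lemma perD_succ (ω : PerChain R A) (m : ℕ) :
    perD R A ω (m + 1) = b R A (m + 1) (ω (m + 2)) + B R A m (ω m) := rfl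

lemma perD_perD (ω : PerChain R A) : perD R A (perD R A ω) = 0 := by
  funext m
  rcases m with - | - | m
  · rw [perD_zero, perD_succ, map_add, b_b, b_B_zero, add_zero]; rfl
  · rw [perD_succ, perD_succ, perD_zero, map_add, b_b, b_B_succ]
    change 0 + -_ + _ = (0 : Chain R A 1)
    rw [zero_add, neg_add_cancel]
  · rw [perD_succ, perD_succ, perD_succ, map_add, map_add, b_b, b_B_succ, B_B, zero_add, add_zero]
    exact neg_add_cancel _

end MixedComplex

/-! ### The homotopy attached to an idempotent -/

section Homotopy

/-- The cancellation behind the fact that a simplicial homotopy `h` gives a chain homotopy: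
`X j p` and `Y p j` stand for `dⱼ hₚ x` and `hₚ dⱼ x`, with the sign `(-1)ʲ⁺ᵖ`. -/
lemma sum_homotopy {G : Type*} [AddCommGroup G] (X Y : ℕ → ℕ → G) (n : ℕ)
    (h₁ : ∀ j p, j ≤ p → p < n → X j (p + 1) = -Y p j)
    (h₂ : ∀ j p, p < j → j ≤ n → X (j + 1) p = -Y p j)
    (h₃ : ∀ p < n, X (p + 1) (p + 1) = -X (p + 1) p) :
    ∑ p ∈ Finset.range (n + 1), ∑ j ∈ Finset.range (n + 2), X j p
      + ∑ p ∈ Finset.range n, ∑ j ∈ Finset.range (n + 1), Y p j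
      = X 0 0 + X (n + 1) n := by
  induction n with
  | zero => simp [Finset.sum_range_succ]
  | succ n ih =>
    have e₀ := ih (fun j p hj hp => h₁ j p hj (by omega)) (fun j p hj hp => h₂ j p hj (by omega))
      fun p hp => h₃ p (by omega)
    have e₁ : ∑ p ∈ Finset.range (n + 1), X (n + 2) p
        = -(∑ p ∈ Finset.range n, Y p (n + 1)) - Y n (n + 1) := by
      rw [Finset.sum_congr rfl fun p hp =>
        h₂ (n + 1) p (Finset.mem_range.1 hp) le_rfl, Finset.sum_neg_distrib, Finset.sum_range_succ]
      abel
    have e₂ : ∑ j ∈ Finset.range (n + 3), X j (n + 1)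
        = -(∑ j ∈ Finset.range (n + 1), Y n j) - X (n + 1) n + X (n + 2) (n + 1) := by
      rw [Finset.sum_range_succ, Finset.sum_range_succ, Finset.sum_congr rfl fun j hj =>
        h₁ j n (Nat.lt_succ_iff.1 (Finset.mem_range.1 hj)) n.lt_succ_self, h₃ n n.lt_succ_self,
        Finset.sum_neg_distrib]
      abel
    have e₃ : ∑ p ∈ Finset.range (n + 1), ∑ j ∈ Finset.range (n + 2), Y p j
        = ∑ p ∈ Finset.range n, ∑ j ∈ Finset.range (n + 1), Y p j
          + ∑ p ∈ Finset.range n, Y p (n + 1) + ∑ j ∈ Finset.range (n + 1), Y n j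
          + Y n (n + 1) := by
      rw [Finset.sum_range_succ]
      simp only [Finset.sum_range_succ _ (n + 1)]
      rw [Finset.sum_add_distrib]
      abel
    rw [Finset.sum_range_succ _ (n + 1), e₂, e₃]
    simp only [Finset.sum_range_succ _ (n + 2)]
    rw [Finset.sum_add_distrib, e₁, ← add_sub_cancel_left (X 0 0) (X (n + 2) (n + 1)),
      eq_sub_of_add_eq e₀]
    abel

variable {R : Type*} [CommRing R] {A : Type*} [Ring A] [Algebra R A]

/-- The sequence `(c a₀, …, c aₚ, c, aₚ₊₁, aₚ₊₂, …)`. -/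
def insertSeq (c : A) (p : ℕ) (a : ℕ → A) : ℕ → A := fun k =>
  if k ≤ p then c * a k else if k = p + 1 then c else a (k - 1)

variable (R) in
/-- The map `a₀ ⊗ ⋯ ⊗ aₙ ↦ c a₀ ⊗ ⋯ ⊗ c aₚ ⊗ c ⊗ aₚ₊₁ ⊗ ⋯ ⊗ aₙ`, for `p ≤ n`. -/
def insertMap (c : A) (n p : ℕ) : Chain R A n →ₗ[R] Chain R A (n + 1) :=
  PiTensorProduct.lift ((PiTensorProduct.tprod R :
      MultilinearMap R (fun _ : Fin (n + 2) => A) _).curryMid (Fin.ofNat (n + 2) (p + 1)) c) ∘ₗ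
    PiTensorProduct.map fun k : Fin (n + 1) =>
      if (k : ℕ) ≤ p then LinearMap.mulLeft R c else LinearMap.id

lemma insertMap_pureChain (c : A) {n p : ℕ} (hp : p ≤ n) (a : ℕ → A) :
    insertMap R c n p (pureChain R n a) = pureChain R (n + 1) (insertSeq c p a) := by
  rw [insertMap, LinearMap.comp_apply, pureChain, PiTensorProduct.map_tprod,
    PiTensorProduct.lift.tprod]
  refine congrArg (PiTensorProduct.tprod R) (funext fun i => ?_)
  have hv : ((Fin.ofNat (n + 2) (p + 1) : Fin (n + 2)) : ℕ) = p + 1 :=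
    Nat.mod_eq_of_lt (by omega)
  refine Fin.succAboveCases (Fin.ofNat (n + 2) (p + 1)) ?_ (fun j => ?_) i
  · rw [Fin.insertNth_apply_same, insertSeq, hv]
    simp
  · rw [Fin.insertNth_apply_succAbove]
    by_cases h : (j : ℕ) ≤ p
    · rw [Fin.succAbove_of_castSucc_lt _ _ (by rw [Fin.lt_def, hv]; simp; omega)]
      simp [insertSeq, h]
    · rw [Fin.succAbove_of_le_castSucc _ _ (by rw [Fin.le_def, hv]; simp; omega)]
      simp only [insertSeq, h, if_false, Fin.val_succ, LinearMap.id_apply]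
      rw [if_neg (by omega), if_neg (by omega), Nat.add_sub_cancel]

variable (R) in
/-- The chain homotopy `∑ₚ (-1)ᵖ hₚ`, where
`hₚ (a₀ ⊗ ⋯ ⊗ aₙ) = c a₀ ⊗ ⋯ ⊗ c aₚ ⊗ c ⊗ aₚ₊₁ ⊗ ⋯ ⊗ aₙ`. -/
def homotopy (c : A) (n : ℕ) : Chain R A n →ₗ[R] Chain R A (n + 1) :=
  ∑ p ∈ Finset.range (n + 1), (-1 : R) ^ p • insertMap R c n p

section Identities

variable {c : A} (hc : IsIdempotentElem c) {a : ℕ → A} (ha : ∀ k, Commute c (a k))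
include hc ha

lemma cyclicFace_insertSeq_of_le {n j p : ℕ} (hj : j ≤ p) (hp : p ≤ n) (k : ℕ) :
    cyclicFace (n + 1) j (insertSeq c (p + 1) a) k = insertSeq c p (cyclicFace n j a) k := by
  have h₁ : ∀ k l, c * a k * (c * a l) = c * (a k * a l) := fun k l => by
    rw [mul_assoc, ← mul_assoc (a k), ← (ha k).eq, mul_assoc, ← mul_assoc c, hc.eq]
  rw [cyclicFace, if_neg (by omega), cyclicFace, if_neg (by omega)]
  simp only [contract, insertSeq]
  split_ifs <;> first | rfl | omega | exact h₁ _ _ | (congr 1; omega)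

omit hc in
lemma cyclicFace_insertSeq_of_lt {n j p : ℕ} (hj : p < j) (k : ℕ) :
    cyclicFace (n + 1) (j + 1) (insertSeq c p a) k = insertSeq c p (cyclicFace n j a) k := by
  have h₁ : ∀ k l, a k * (c * a l) = c * (a k * a l) := fun k l => by
    rw [← mul_assoc, ← (ha k).eq, mul_assoc]
  rw [cyclicFace, cyclicFace]
  by_cases hjn : j = n + 1
  · rw [if_pos (by omega), if_pos hjn]
    simp only [contract, rotate, insertSeq]
    split_ifs <;> first | rfl | omega | contradiction | exact h₁ _ _
  · rw [if_neg (by omega), if_neg hjn]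
    grind [contract, insertSeq]

lemma cyclicFace_insertSeq_self {n p : ℕ} (hp : p ≤ n) (k : ℕ) :
    cyclicFace (n + 1) (p + 1) (insertSeq c (p + 1) a) k
      = cyclicFace (n + 1) (p + 1) (insertSeq c p a) k := by
  have h₁ : ∀ k, c * a k * c = c * a k := fun k => by
    rw [mul_assoc, ← (ha k).eq, ← mul_assoc, hc.eq]
  rw [cyclicFace, if_neg (by omega), cyclicFace, if_neg (by omega)]
  simp only [contract, insertSeq]
  split_ifs <;> first | rfl | omega | exact h₁ _

lemma cyclicFace_insertSeq_zero (n k : ℕ) :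
    cyclicFace n 0 (insertSeq c 0 a) k = if k = 0 then c * a 0 else a k := by
  rw [cyclicFace, if_neg (by omega)]
  rcases k with - | k
  · simp [contract, insertSeq, (ha 0).eq, mul_assoc, hc.eq]
  · simp [contract, insertSeq]

omit ha in
lemma cyclicFace_insertSeq_last (n k : ℕ) (hk : k ≤ n) :
    cyclicFace n (n + 1) (insertSeq c n a) k = c * a k := by
  rw [cyclicFace, if_pos rfl]
  rcases k with - | k
  · simp [contract, rotate, insertSeq, ← mul_assoc, hc.eq]
  · simp [contract, rotate, insertSeq, hk]

end Identities

variable (R) in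
/-- The map `a₀ ⊗ ⋯ ⊗ aₙ ↦ c a₀ ⊗ a₁ ⊗ ⋯ ⊗ aₙ`. -/
def mulHead (c : A) (n : ℕ) : Chain R A n →ₗ[R] Chain R A n :=
  PiTensorProduct.map fun k : Fin (n + 1) =>
    if (k : ℕ) = 0 then LinearMap.mulLeft R c else LinearMap.id

variable (R) in
/-- The map `a₀ ⊗ ⋯ ⊗ aₙ ↦ c a₀ ⊗ c a₁ ⊗ ⋯ ⊗ c aₙ`. -/
def mulAll (c : A) (n : ℕ) : Chain R A n →ₗ[R] Chain R A n :=
  PiTensorProduct.map fun _ => LinearMap.mulLeft R c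

lemma mulHead_pureChain (c : A) (n : ℕ) (a : ℕ → A) :
    mulHead R c n (pureChain R n a) = pureChain R n fun k => if k = 0 then c * a 0 else a k := by
  rw [mulHead, pureChain, PiTensorProduct.map_tprod]
  refine congrArg (PiTensorProduct.tprod R) (funext fun i => ?_)
  split_ifs with h
  · rw [LinearMap.mulLeft_apply, h]
    rfl
  · exact (if_neg h).symm

lemma mulAll_pureChain (c : A) (n : ℕ) (a : ℕ → A) :
    mulAll R c n (pureChain R n a) = pureChain R n fun k => c * a k :=
  PiTensorProduct.map_tprod _ _

/-- The map `mulHead` is additive in the multiplier, and `1` acts as the identity. -/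
lemma sum_mulHead {ι : Type*} (t : Finset ι) (c : ι → A) (h : ∑ i ∈ t, c i = 1) (n : ℕ)
    (x : Chain R A n) : ∑ i ∈ t, mulHead R (c i) n x = x := by
  suffices h : ∑ i ∈ t, mulHead R (c i) n = LinearMap.id by
    rw [← LinearMap.sum_apply, h, LinearMap.id_apply]
  refine chain_hom_ext fun a => ?_
  have key : ∀ y : A, pureChain R n (fun k => if k = 0 then y * a 0 else a k)
      = ((PiTensorProduct.tprod R : MultilinearMap R (fun _ : Fin (n + 1) => A) _).toLinearMap
          (fun i => a i) 0 ∘ₗ LinearMap.mulRight R (a 0)) y := fun y => by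
    refine congrArg (PiTensorProduct.tprod R) (funext fun i => ?_)
    refine Fin.cases ?_ (fun i => ?_) i <;> simp
  rw [LinearMap.sum_apply, Finset.sum_congr rfl fun i _ => (mulHead_pureChain _ _ _).trans (key _),
    ← map_sum, h, ← key, LinearMap.id_apply]
  refine pureChain_congr fun k _ => ?_
  rcases k with - | k <;> simp

lemma homotopy_pureChain (c : A) (n : ℕ) (a : ℕ → A) :
    homotopy R c n (pureChain R n a)
      = ∑ p ∈ Finset.range (n + 1), (-1 : R) ^ p • pureChain R (n + 1) (insertSeq c p a) := by
  rw [homotopy, LinearMap.sum_apply]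
  refine Finset.sum_congr rfl fun p hp => ?_
  rw [LinearMap.smul_apply, insertMap_pureChain c (Nat.lt_succ_iff.1 (Finset.mem_range.1 hp))]

section

variable {c : A} (hc : IsIdempotentElem c) {a : ℕ → A} (ha : ∀ k, Commute c (a k))
include hc ha

lemma b_homotopy_pureChain_zero :
    b R A 0 (homotopy R c 0 (pureChain R 0 a))
      = mulHead R c 0 (pureChain R 0 a) - mulAll R c 0 (pureChain R 0 a) := by
  rw [homotopy_pureChain, Finset.sum_range_one, pow_zero, one_smul, b_pureChain,
    Finset.sum_range_succ, Finset.sum_range_one, mulHead_pureChain, mulAll_pureChain,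
    pureChain_congr fun k _ => cyclicFace_insertSeq_zero hc ha 0 k,
    pureChain_congr fun k hk => cyclicFace_insertSeq_last hc 0 k hk]
  simp [sub_eq_add_neg]

/-- On chains whose entries commute with `c`, the maps `hₚ` form a simplicial homotopy; its two ends
are `d₀ h₀`, the multiplication of the first factor, and `dₙ₊₂ hₙ₊₁`, the multiplication of all
factors. -/
lemma b_homotopy_pureChain_succ (n : ℕ) :
    b R A (n + 1) (homotopy R c (n + 1) (pureChain R (n + 1) a))
        + homotopy R c n (b R A n (pureChain R (n + 1) a))
      = mulHead R c (n + 1) (pureChain R (n + 1) a)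
        - mulAll R c (n + 1) (pureChain R (n + 1) a) := by
  simp only [homotopy_pureChain, b_pureChain, map_sum, map_smul, Finset.smul_sum]
  rw [Finset.sum_comm (s := Finset.range (n + 2)) (t := Finset.range (n + 1))]
  refine (sum_homotopy
    (fun j p => (-1 : R) ^ p • (-1 : R) ^ j •
      pureChain R (n + 1) (cyclicFace (n + 1) j (insertSeq c p a)))
    (fun p j => (-1 : R) ^ j • (-1 : R) ^ p •
      pureChain R (n + 1) (insertSeq c p (cyclicFace n j a))) (n + 1) ?_ ?_ ?_).trans ?_
  · intro j p hj hp
    rw [pureChain_congr fun k _ => cyclicFace_insertSeq_of_le hc ha hj (Nat.lt_succ_iff.1 hp) k,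
      pow_succ, mul_neg_one, neg_smul, smul_comm]
  · intro j p hj hp
    rw [pureChain_congr fun k _ => cyclicFace_insertSeq_of_lt ha hj k,
      pow_succ, mul_neg_one, neg_smul, smul_neg, smul_comm]
  · intro p hp
    rw [pureChain_congr fun k _ => cyclicFace_insertSeq_self hc ha (Nat.lt_succ_iff.1 hp) k,
      pow_succ, mul_neg_one, neg_smul]
  · have : (-1 : R) ^ (n + 1) * (-1 : R) ^ (n + 1 + 1) = -1 := by
      rw [pow_succ _ (n + 1), ← mul_assoc, ← mul_pow]; simp
    rw [pureChain_congr fun k _ => cyclicFace_insertSeq_zero hc ha (n + 1) k,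
      pureChain_congr fun k hk => cyclicFace_insertSeq_last hc (n + 1) k hk, mulHead_pureChain,
      mulAll_pureChain, smul_smul _ _ (pureChain R (n + 1) fun k => c * a k), this]
    simp [sub_eq_add_neg]

end

/-- Let `c` be an idempotent which commutes with the elements of `S`. Multiplying the first factor
of a cycle with entries in `S` by `c` has, up to a boundary, the same effect as multiplying each
factor by `c`. -/
lemma b_homotopy_of_mem_cycles {c : A} (hc : IsIdempotentElem c) {S : Set A}
    (hS : ∀ v ∈ S, Commute c v) {n : ℕ} {x : Chain R A n} (hx : x ∈ spanChain R S n)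
    (hx' : x ∈ hochschildCycles R A n) :
    b R A n (homotopy R c n x) = mulHead R c n x - mulAll R c n x := by
  rcases n with - | n
  · refine LinearMap.eqOn_span (f := b R A 0 ∘ₗ homotopy R c 0)
      (g := mulHead R c 0 - mulAll R c 0) ?_ hx
    rintro _ ⟨a, ha, rfl⟩
    exact b_homotopy_pureChain_zero hc fun k => hS _ (ha k)
  · have h := LinearMap.eqOn_span
      (f := b R A (n + 1) ∘ₗ homotopy R c (n + 1) + homotopy R c n ∘ₗ b R A n)
      (g := mulHead R c (n + 1) - mulAll R c (n + 1))
      (s := pureChain R (n + 1) '' {a | ∀ k, a k ∈ S})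
      (by
        rintro _ ⟨a, ha, rfl⟩
        exact b_homotopy_pureChain_succ hc (fun k => hS _ (ha k)) n) hx
    simpa [LinearMap.mem_ker.1 hx'] using h

end Homotopy

/-! ### Local units -/

section LocalUnits

variable {B : Type*} [NonUnitalRing B] [Module ℂ B] [IsScalarTower ℂ B B] [SMulCommClass ℂ B B]

/-- Every finite subset of `B` is contained in one of the corners `e_k B e_k`, although these are not
assumed to be nested: the finite-dimensional space of linear combinations of the set is
covered by countably many of its closed subspaces, so one of them is the whole space. -/
lemma exists_idempotent_fixing {e : ℕ → B} (he : ∀ k, IsIdempotentElem (e k))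
    (hcorner : ⋃ k, Set.range (fun x : B => e k * x * e k) = Set.univ) {S : Set B}
    (hS : S.Finite) : ∃ k, ∀ x ∈ S, e k * x = x ∧ x * e k = x := by
  classical
  let W : ℕ → Submodule ℂ B := fun k =>
    LinearMap.eqLocus (LinearMap.mulLeft ℂ (e k)) LinearMap.id
      ⊓ LinearMap.eqLocus (LinearMap.mulRight ℂ (e k)) LinearMap.id
  have : Fintype S := hS.fintype
  let f : (S → ℂ) →ₗ[ℂ] B := Fintype.linearCombination ℂ (Subtype.val : S → B)
  obtain ⟨k, hk⟩ := nonempty_interior_of_iUnion_of_closed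
    (f := fun k => (((W k).comap f : Submodule ℂ (S → ℂ)) : Set (S → ℂ)))
    (fun k => Submodule.closed_of_finiteDimensional _) <| Set.eq_univ_of_forall fun c => by
      obtain ⟨k, y, hy⟩ := Set.mem_iUnion.1 (hcorner.symm ▸ Set.mem_univ (f c))
      refine Set.mem_iUnion.2 ⟨k, ?_, ?_⟩
      · change e k * f c = f c
        rw [← hy, ← mul_assoc, ← mul_assoc, (he k).eq]
      · change f c * e k = f c
        rw [← hy, mul_assoc, (he k).eq]
  refine ⟨k, fun x hx => ?_⟩
  have h : (Pi.single ⟨x, hx⟩ 1 : S → ℂ) ∈ (W k).comap f := by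
    exact Submodule.eq_top_of_nonempty_interior' _ hk ▸ Submodule.mem_top
  have hf : f (Pi.single ⟨x, hx⟩ 1) = x := by simp [f]
  rw [Submodule.mem_comap, hf] at h
  exact h

end LocalUnits

/-! ### Projections onto the ideals -/

section Ideals

variable {R : Type*} [CommRing R] {B : Type*} [NonUnitalRing B] [Module R B]
  [IsScalarTower R B B] [SMulCommClass R B B]

/-- The projections of `B` onto its summands are multiplicative, since distinct summands are ideals
with zero intersection and hence annihilate each other. -/
lemma exists_projections {I : ℕ → NonUnitalSubalgebra R B} (hI : ∀ n, IsTwoSidedIdeal (I n))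
    (hsum : DirectSum.IsInternal fun n => (I n).toSubmodule) :
    ∃ p : ∀ i, B →ₙₐ[R] I i, (∀ i (x : I i), p i x = x) ∧
      (∀ i j, i ≠ j → ∀ x : I j, p i x = 0) ∧
      ∀ x, ∃ F : Finset ℕ, x = ∑ i ∈ F, (p i x : B) := by
  let D := LinearEquiv.ofBijective (DirectSum.coeLinearMap fun n => (I n).toSubmodule) hsum
  let p : ∀ i, B →ₗ[R] I i := fun i =>
    (DirectSum.component R ℕ (fun i => (I i).toSubmodule) i) ∘ₗ D.symm.toLinearMap
  have hD : ∀ j (x : I j), D.symm x = DirectSum.lof R ℕ (fun i => (I i).toSubmodule) j x :=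
    fun j x => by
      rw [LinearEquiv.symm_apply_eq]
      exact (DirectSum.coeLinearMap_lof (fun n => (I n).toSubmodule) j x).symm
  have h₁ : ∀ i (x : I i), p i x = x := fun i x => by
    change DirectSum.component R ℕ (fun i => (I i).toSubmodule) i (D.symm x) = x
    rw [hD]
    exact DirectSum.component.lof_self R (M := fun i => (I i).toSubmodule) i x
  have h₂ : ∀ i j, i ≠ j → ∀ x : I j, p i x = 0 := fun i j hij x => by
    change DirectSum.component R ℕ (fun i => (I i).toSubmodule) i (D.symm x) = 0
    rw [hD, DirectSum.component.of, dif_neg hij.symm]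
  have h₃ : ∀ x, ∃ F : Finset ℕ, x = ∑ i ∈ F, (p i x : B) := fun x => by
    classical
    refine ⟨DFinsupp.support (D.symm x), ?_⟩
    conv_lhs => rw [← D.apply_symm_apply x]
    exact DirectSum.coeLinearMap_eq_dfinsuppSum _ _
  -- a linear map which kills the components of `x` other than `pᵢ x` sees only `pᵢ x`
  have h₄ : ∀ i (L : B →ₗ[R] B) (x : B), (∀ j, i ≠ j → L (p j x) = 0) → L x = L (p i x) := by
    intro i L x hL
    obtain ⟨F, hF⟩ := h₃ x
    conv_lhs => rw [hF, map_sum]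
    refine Finset.sum_eq_single i (fun j _ hj => hL j hj.symm) fun hi => ?_
    have : p i x = 0 := by
      rw [hF, map_sum]
      exact Finset.sum_eq_zero fun j hj => h₂ i j (fun h => hi (h ▸ hj)) _
    rw [this, ZeroMemClass.coe_zero, map_zero]
  -- `x pⱼ(y)` lies in `I i` and in `I j`, hence vanishes for `j ≠ i`
  have h₅ : ∀ i (x : I i) (y : B), (x : B) * y = x * p i y := fun i x y =>
    h₄ i (LinearMap.mulLeft R (x : B)) y fun j hij => by
      have hi := h₁ i ⟨x * p j y, (hI i (p j y) _ x.2).2⟩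
      have hj := h₂ i j hij ⟨x * p j y, (hI j x _ (p j y).2).1⟩
      exact congrArg Subtype.val (hi.symm.trans hj)
  refine ⟨fun i => { p i with map_zero' := (p i).map_zero, map_mul' := fun x y => ?_ }, h₁, h₂, h₃⟩
  have h := h₄ i ((I i).toSubmodule.subtype ∘ₗ p i ∘ₗ LinearMap.mulRight R y) x fun j hij =>
    congrArg Subtype.val (h₂ i j hij ⟨p j x * y, (hI j y _ (p j x).2).2⟩)
  refine Subtype.ext (h.trans ?_)
  have h' := h₁ i ⟨p i x * y, (hI i y _ (p i x).2).2⟩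
  exact (congrArg Subtype.val h').trans (h₅ i (p i x) y)

end Ideals

/-! ### Hochschild cycles of the unitization -/

section Decomposition

variable {B : Type*} [NonUnitalRing B] [Module ℂ B] [IsScalarTower ℂ B B] [SMulCommClass ℂ B B]
  {I : ℕ → NonUnitalSubalgebra ℂ B} (hI : ∀ n, IsTwoSidedIdeal (I n))
  {p : ∀ i, B →ₙₐ[ℂ] I i} (hp : ∀ i (x : I i), p i x = x)
  (hpF : ∀ x, ∃ F : Finset ℕ, x = ∑ i ∈ F, (p i x : B))
  {e : ℕ → B} (he : ∀ k, IsIdempotentElem (e k))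
  (hcorner : ⋃ k, Set.range (fun x : B => e k * x * e k) = Set.univ)

/-- The inclusion of an ideal of `B` into the unitization of `B`, as a linear map. -/
def inclUnitization (J : NonUnitalSubalgebra ℂ B) : J →ₗ[ℂ] Unitization ℂ B :=
  Unitization.inrHom ℂ ℂ B ∘ₗ J.toSubmodule.subtype

include hI hp hpF he hcorner

/-- A Hochschild cycle of `B⁺` which is killed by the augmentation is homologous to a finite sum of
cycles of the ideals. -/
lemma exists_eq_b_add_sum {n : ℕ} {x : Chain ℂ (Unitization ℂ B) n}
    (hx : x ∈ hochschildCycles ℂ (Unitization ℂ B) n)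
    (hε : mapChain (Unitization.fstHom ℂ B).toLinearMap n x = 0) :
    ∃ (F : Finset ℕ) (y : Chain ℂ (Unitization ℂ B) (n + 1)) (z : ∀ i, Chain ℂ (I i) n),
      (∀ i, z i ∈ hochschildCycles ℂ (I i) n) ∧
        x = b ℂ (Unitization ℂ B) n y + ∑ i ∈ F, mapChain (inclUnitization (I i)) n (z i) := by
  obtain ⟨S₀, hS₀, hxS₀⟩ := exists_mem_spanChain n x
  obtain ⟨k, hk⟩ := exists_idempotent_fixing he hcorner (hS₀.image fun v => v.snd)
  obtain ⟨F, hF⟩ := hpF (e k)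
  let S : Set (Unitization ℂ B) := {v | e k * v.snd = v.snd ∧ v.snd * e k = v.snd}
  have hxS : x ∈ spanChain ℂ S n :=
    spanChain_mono (fun v hv => hk _ (Set.mem_image_of_mem _ hv)) n hxS₀
  have hmul : ∀ i w, (p i (e k) : B) * w = p i (e k * w) := fun i w => by
    have := hp i ⟨p i (e k) * w, (hI i w _ (p i (e k)).2).2⟩
    rw [map_mul, hp] at this
    rw [map_mul, this]
  have hmul' : ∀ i w, w * (p i (e k) : B) = p i (w * e k) := fun i w => by
    have := hp i ⟨w * p i (e k), (hI i w _ (p i (e k)).2).1⟩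
    rw [map_mul, hp] at this
    rw [map_mul, this]
  -- the idempotents `eᵢ = pᵢ e`, for `i ∈ F`, and `1 - e = 1 - ∑ eᵢ`, where `e = e k`
  let c : Option ℕ → Unitization ℂ B := fun o => o.elim (1 - Unitization.inr (e k))
    fun i => Unitization.inr (p i (e k) : B)
  have hsum : ∑ o ∈ F.insertNone, c o = 1 := by
    rw [Finset.sum_insertNone]
    change 1 - Unitization.inrHom ℂ ℂ B (e k) + ∑ i ∈ F, Unitization.inrHom ℂ ℂ B (p i (e k)) = 1
    rw [← map_sum, ← hF, sub_add_cancel]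
  have hidem : ∀ o, IsIdempotentElem (c o) := by
    rintro (- | i)
    · exact ((he k).map (Unitization.inrNonUnitalAlgHom ℂ B)).one_sub
    · exact ((he k).map (p i)).map
        ((Unitization.inrNonUnitalAlgHom ℂ B).comp (NonUnitalSubalgebraClass.subtype (I i)))
  have hcomm : ∀ o, ∀ v ∈ S, Commute (c o) v := by
    have key : ∀ (w : B) (v : Unitization ℂ B), w * v.snd = v.snd * w →
        Commute (Unitization.inr w) v := fun w v h => by
      rw [commute_iff_eq]
      refine Unitization.ext ?_ ?_ <;> simp [h]
    rintro (- | i) v ⟨hv, hv'⟩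
    · exact (Commute.one_left v).sub_left (key _ _ (hv.trans hv'.symm))
    · exact key _ _ (by rw [hmul, hmul', hv, hv'])
  -- `E i` is a linear map on all of `B⁺` which, on `S`, is the multiplication by `eᵢ`; it is
  -- multiplicative on `S` only
  let E : ∀ i, Unitization ℂ B →ₗ[ℂ] I i := fun i =>
    LinearMap.toSpanSingleton ℂ _ (p i (e k)) ∘ₗ (Unitization.fstHom ℂ B).toLinearMap
      + (p i : B →ₗ[ℂ] I i) ∘ₗ Unitization.sndHom ℂ ℂ B
  have hE : ∀ i, ∀ v ∈ S, inclUnitization (I i) (E i v) = c (some i) * v := by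
    rintro i v ⟨hv, -⟩
    have h : (E i v : B) = v.fst • (p i (e k) : B) + p i v.snd := rfl
    refine Unitization.ext ?_ ?_
    · simp [inclUnitization, c]
    · refine Eq.trans (b := (E i v : B)) rfl ?_
      simp [c, h, hmul, hv]
  have hSmul : ∀ u ∈ S, ∀ v ∈ S, u * v ∈ S := by
    rintro u ⟨hu, hu'⟩ v ⟨hv, hv'⟩
    constructor
    · simp [mul_add, mul_smul_comm, ← mul_assoc, hu, hv]
    · simp [add_mul, smul_mul_assoc, mul_assoc, hu', hv']
  have hinj : ∀ i, Function.Injective (inclUnitization (I i)) := fun i =>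
    Unitization.inr_injective.comp Subtype.val_injective
  have hEmul : ∀ i, ∀ u ∈ S, ∀ v ∈ S, E i (u * v) = E i u * E i v := by
    intro i u hu v hv
    apply hinj i
    have h : inclUnitization (I i) (E i u * E i v)
        = inclUnitization (I i) (E i u) * inclUnitization (I i) (E i v) :=
      map_mul ((Unitization.inrNonUnitalAlgHom ℂ B).comp (NonUnitalSubalgebraClass.subtype (I i)))
        _ _
    rw [h, hE i _ (hSmul u hu v hv), hE i u hu, hE i v hv, mul_assoc, ← mul_assoc u,
      ← (hcomm (some i) u hu).eq, mul_assoc, ← mul_assoc (c _) (c _), (hidem _).eq]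
  -- on `S`, multiplication by `1 - e` factors through the augmentation
  have hnone : mulAll ℂ (c none) n x = 0 := by
    have h : mulAll ℂ (c none) n x = mapChain (LinearMap.toSpanSingleton ℂ _ (c none)) n
        (mapChain (Unitization.fstHom ℂ B).toLinearMap n x) := by
      refine LinearMap.eqOn_span (f := mulAll ℂ (c none) n)
        (g := mapChain (LinearMap.toSpanSingleton ℂ _ (c none)) n ∘ₗ
          mapChain (Unitization.fstHom ℂ B).toLinearMap n) ?_ hxS
      rintro _ ⟨a, ha, rfl⟩
      simp only [LinearMap.comp_apply, mapChain_pureChain, mulAll_pureChain]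
      refine pureChain_congr fun m _ => ?_
      refine Unitization.ext ?_ ?_
      · simp [c, sub_eq_add_neg]
      · simp [c, sub_eq_add_neg, (ha m).1]
    rw [h, hε, map_zero]
  have hsome : ∀ i, mulAll ℂ (c (some i)) n x
      = mapChain (inclUnitization (I i)) n (mapChain (E i) n x) := by
    intro i
    refine LinearMap.eqOn_span (f := mulAll ℂ (c (some i)) n)
      (g := mapChain (inclUnitization (I i)) n ∘ₗ mapChain (E i) n) ?_ hxS
    rintro _ ⟨a, ha, rfl⟩
    simp only [LinearMap.comp_apply, mapChain_pureChain, mulAll_pureChain]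
    exact pureChain_congr fun m _ => (hE i _ (ha m)).symm
  refine ⟨F, ∑ o ∈ F.insertNone, homotopy ℂ (c o) n x, fun i => mapChain (E i) n x,
    fun i => mapChain_mem_hochschildCycles _ (hEmul i) hxS hx, ?_⟩
  rw [map_sum, Finset.sum_congr rfl fun o _ => b_homotopy_of_mem_cycles (hidem o) (hcomm o) hxS hx,
    Finset.sum_sub_distrib, sum_mulHead _ _ hsum, Finset.sum_insertNone, hnone, zero_add,
    Finset.sum_congr rfl fun i _ => hsome i, sub_add_cancel]

end Decomposition

/-! ### Functoriality of periodic cyclic homology -/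

section Functoriality

section Unital

variable {R : Type*} [CommRing R] {A : Type*} [Ring A] [Algebra R A] {A' : Type*} [Ring A']
  [Algebra R A'] {A'' : Type*} [Ring A''] [Algebra R A'']

lemma perMap_id (ω : PerChain R A) : perMap (AlgHom.id R A) ω = ω :=
  funext fun n => mapChain_id n (ω n)

lemma perMap_comp (g : A' →ₐ[R] A'') (f : A →ₐ[R] A') (ω : PerChain R A) :
    perMap (g.comp f) ω = perMap g (perMap f ω) :=
  funext fun n => chainMap_comp g f n (ω n)

end Unital

variable {R : Type*} [CommRing R] {A : Type*} [NonUnitalRing A] [Module R A]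
  [IsScalarTower R A A] [SMulCommClass R A A] {A' : Type*} [NonUnitalRing A'] [Module R A']
  [IsScalarTower R A' A'] [SMulCommClass R A' A'] {A'' : Type*} [NonUnitalRing A''] [Module R A'']
  [IsScalarTower R A'' A''] [SMulCommClass R A'' A'']

lemma unitizationMap_inr (f : A →ₙₐ[R] A') (a : A) :
    unitizationMap f (Unitization.inr a) = Unitization.inr (f a) := by
  simp [unitizationMap]

lemma unitizationMap_comp (g : A' →ₙₐ[R] A'') (f : A →ₙₐ[R] A') :
    unitizationMap (g.comp f) = (unitizationMap g).comp (unitizationMap f) := by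
  refine Unitization.algHom_ext'' fun a => ?_
  simp [unitizationMap_inr]

lemma fstHom_comp_unitizationMap (f : A →ₙₐ[R] A') :
    (Unitization.fstHom R A').comp (unitizationMap f) = Unitization.fstHom R A := by
  refine Unitization.algHom_ext'' fun a => ?_
  change (unitizationMap f (Unitization.inr a)).fst = 0
  rw [unitizationMap_inr, Unitization.fst_inr]

lemma HP.map_comp (g : A' →ₙₐ[R] A'') (f : A →ₙₐ[R] A') (q : ZMod 2) (x : HP R A q) :
    HP.map (g.comp f) q x = HP.map g q (HP.map f q x) := by
  obtain ⟨x, rfl⟩ := Submodule.Quotient.mk_surjective _ x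
  refine congrArg (Submodule.Quotient.mk (p := HP.scalars R A'' q)) ?_
  rw [unitizationMap_comp, HPUnital.map_comp]

/-- The class in `HP_q(A)` of a periodic cyclic cycle of `A⁺`. -/
def HP.mk (q : ZMod 2) : perCycles R (Unitization R A) q →ₗ[R] HP R A q :=
  (HP.scalars R A q).mkQ ∘ₗ
    ((perBoundaries R (Unitization R A) q).submoduleOf (perCycles R (Unitization R A) q)).mkQ

lemma HP.mk_surjective (q : ZMod 2) : Function.Surjective (HP.mk (R := R) (A := A) q) :=
  (Submodule.mkQ_surjective _).comp (Submodule.mkQ_surjective _)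

lemma HP.mk_eq_zero_of_mem_perBoundaries {q : ZMod 2} {ω : perCycles R (Unitization R A) q}
    (h : (ω : PerChain R (Unitization R A)) ∈ perBoundaries R (Unitization R A) q) :
    HP.mk q ω = 0 := by
  have h' : ((perBoundaries R (Unitization R A) q).submoduleOf
      (perCycles R (Unitization R A) q)).mkQ ω = 0 := (Submodule.Quotient.mk_eq_zero _).2 h
  exact (congrArg (HP.scalars R A q).mkQ h').trans (map_zero _)

lemma HP.map_mk (f : A →ₙₐ[R] A') (q : ZMod 2) (ω : perCycles R (Unitization R A) q) :
    HP.map f q (HP.mk q ω)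
      = HP.mk q ⟨perMap (unitizationMap f) ω, perMap_perCycles _ q _ ω.2⟩ := rfl

lemma HP.mk_scalars (q : ZMod 2) (ω : perCycles R R q) :
    HP.mk q (⟨perMap (Algebra.ofId R (Unitization R A)) ω, perMap_perCycles _ q _ ω.2⟩ :
      perCycles R (Unitization R A) q) = 0 :=
  (Submodule.Quotient.mk_eq_zero _).2 ⟨Submodule.Quotient.mk ω, rfl⟩

lemma HP.map_id (q : ZMod 2) (x : HP R A q) : HP.map (NonUnitalAlgHom.id R A) q x = x := by
  obtain ⟨ω, rfl⟩ := HP.mk_surjective q x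
  have h : unitizationMap (NonUnitalAlgHom.id R A) = AlgHom.id R (Unitization R A) :=
    Unitization.algHom_ext'' fun a => by simp [unitizationMap_inr]
  have h' : perMap (unitizationMap (NonUnitalAlgHom.id R A)) ω.1 = ω.1 := by rw [h, perMap_id]
  exact (HP.map_mk _ q ω).trans (congrArg (HP.mk q) (Subtype.ext h'))

lemma HP.map_zero_hom (q : ZMod 2) (x : HP R A q) : HP.map (0 : A →ₙₐ[R] A') q x = 0 := by
  obtain ⟨ω, rfl⟩ := HP.mk_surjective q x
  have h : unitizationMap (0 : A →ₙₐ[R] A')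
      = (Algebra.ofId R (Unitization R A')).comp (Unitization.fstHom R A) :=
    Unitization.algHom_ext'' fun a => by
      rw [unitizationMap_inr]
      exact (map_zero (algebraMap R (Unitization R A'))).symm
  have h' : perMap (unitizationMap (0 : A →ₙₐ[R] A')) ω.1
      = perMap (Algebra.ofId R (Unitization R A')) (perMap (Unitization.fstHom R A) ω.1) := by
    rw [h, perMap_comp]
  exact (HP.map_mk _ q ω).trans <| (congrArg (HP.mk q) (Subtype.ext h')).trans <|
    HP.mk_scalars q ⟨perMap (Unitization.fstHom R A) ω.1, perMap_perCycles _ q _ ω.2⟩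

/-- Every class in `HP_q(A)` comes from a cycle which is killed by the augmentation of `A⁺`. -/
lemma HP.exists_reduced (q : ZMod 2) (x : HP R A q) :
    ∃ ω : perCycles R (Unitization R A) q, perMap (Unitization.fstHom R A) ω.1 = 0 ∧
      HP.mk q ω = x := by
  obtain ⟨ω, rfl⟩ := HP.mk_surjective q x
  let ω₀ : perCycles R R q :=
    ⟨perMap (Unitization.fstHom R A) ω.1, perMap_perCycles _ q _ ω.2⟩
  refine ⟨ω - ⟨perMap (Algebra.ofId R (Unitization R A)) ω₀.1, perMap_perCycles _ q _ ω₀.2⟩, ?_, ?_⟩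
  · have h : (Unitization.fstHom R A).comp (Algebra.ofId R (Unitization R A)) = AlgHom.id R R :=
      Subsingleton.elim _ _
    have h' : perMap (Unitization.fstHom R A) (perMap (Algebra.ofId R (Unitization R A)) ω₀.1)
        = ω₀.1 := by
      rw [← perMap_comp, h, perMap_id]
    exact (map_sub _ _ _).trans (sub_eq_zero.2 h'.symm)
  · exact (map_sub _ _ _).trans ((congrArg _ (HP.mk_scalars q ω₀)).trans (sub_zero _))

end Functoriality

/-! ### Periodic cycles without components of low degree -/

section Filling

variable {R : Type*} [CommRing R] {A : Type*} [Ring A] [Algebra R A]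

/-- The solution `η` of `(b + B) η = ω` that is obtained degree by degree from a choice `g` of
preimages under `b`: `ηₙ₊₁ = g (ωₙ - B ηₙ₋₁)`. -/
def solve (g : ∀ n, Chain R A n → Chain R A (n + 1)) (ω : PerChain R A) : PerChain R A
  | 0 => 0
  | 1 => g 0 (ω 0)
  | n + 2 => g (n + 1) (ω (n + 1) - B R A n (solve g ω n))

/-- If a subcomplex `K` of the Hochschild complex, stable under `B`, is acyclic above degree `N`,
then a periodic cyclic cycle in `K` without components of degree at most `N` is a boundary. -/
lemma mem_perBoundaries_of_acyclic (K : ∀ n, Submodule R (Chain R A n))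
    (hB : ∀ n, ∀ x ∈ K n, B R A n x ∈ K (n + 1)) {N : ℕ}
    (hK : ∀ n, N < n → ∀ x ∈ K n, x ∈ hochschildCycles R A n → ∃ y ∈ K (n + 1), b R A n y = x)
    {q : ZMod 2} {ω : PerChain R A} (hω : ω ∈ perCycles R A q) (hωK : ∀ n, ω n ∈ K n)
    (hωN : ∀ n ≤ N, ω n = 0) : ω ∈ perBoundaries R A q := by
  -- the choice of preimages sends `0` to `0`, so that `η` has components of the right parity only
  have hg : ∀ n (x : Chain R A n), ∃ y ∈ K (n + 1), (x = 0 → y = 0) ∧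
      (N < n → x ∈ K n → x ∈ hochschildCycles R A n → b R A n y = x) := fun n x => by
    by_cases h : x ≠ 0 ∧ N < n ∧ x ∈ K n ∧ x ∈ hochschildCycles R A n
    · obtain ⟨y, hy, rfl⟩ := hK n h.2.1 x h.2.2.1 h.2.2.2
      exact ⟨y, hy, fun h' => absurd h' h.1, fun _ _ _ => rfl⟩
    · refine ⟨0, zero_mem _, fun _ => rfl, fun h₁ h₂ h₃ => ?_⟩
      rw [map_zero]
      by_contra h₀
      exact h ⟨fun h' => h₀ h'.symm, h₁, h₂, h₃⟩
  choose g hgK hg₀ hgb using hg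
  have hηK : ∀ n, solve g ω n ∈ K n
    | 0 => zero_mem _
    | 1 => hgK _ _
    | n + 2 => hgK _ _
  have hηN : ∀ n ≤ N + 1, solve g ω n = 0 := by
    intro n
    induction n using Nat.twoStepInduction with
    | zero => exact fun _ => rfl
    | one => exact fun _ => hg₀ 0 _ (hωN 0 N.zero_le)
    | more n ih _ =>
      intro hn
      refine hg₀ _ _ ?_
      rw [ih (by omega), hωN _ (by omega), map_zero, sub_zero]
  have hηq : solve g ω ∈ perGraded R A (q + 1) := by
    intro n
    have h2 : (2 : ZMod 2) = 0 := rfl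
    induction n using Nat.twoStepInduction with
    | zero => exact fun _ => rfl
    | one =>
      refine fun hn => hg₀ 0 _ (hω.2 0 fun h => hn ?_)
      rw [← h]; simp
    | more n ih _ =>
      intro hn
      refine hg₀ _ _ ?_
      have hn' : (n : ZMod 2) ≠ q + 1 := fun h => hn (by push_cast; rw [h, h2, add_zero])
      rw [ih hn', map_zero, sub_zero]
      refine hω.2 _ fun h => hn ?_
      rw [← h]
      push_cast
      ring
  have hD : ∀ m, perD R A ω m = 0 := fun m => congrFun (LinearMap.mem_ker.1 hω.1) m
  refine ⟨solve g ω, hηq, funext fun m => ?_⟩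
  induction m using Nat.strong_induction_on with
  | _ m ih =>
    rcases m with - | m
    · rw [perD_zero, hηN 1 (by omega), map_zero, hωN 0 N.zero_le]
    · rw [perD_succ]
      by_cases hm : m + 1 ≤ N
      · rw [hηN _ (by omega), hηN _ (by omega), hωN _ hm, map_zero, map_zero, add_zero]
      · -- `b (ωₘ₊₁ - B ηₘ) = b ωₘ₊₁ + B b ηₘ = b ωₘ₊₁ + B ωₘ₋₁ = 0`
        have hcyc : b R A m (ω (m + 1) - B R A m (solve g ω m)) = 0 := by
          rcases m with - | m
          · rw [map_sub, b_B_zero, sub_zero]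
            exact hD 0
          · have hBb : B R A m (b R A m (solve g ω (m + 1))) = B R A m (ω m) := by
              rw [← ih m (by omega)]
              rcases m with - | m
              · rw [perD_zero]
              · rw [perD_succ, map_add, B_B, add_zero]
            rw [map_sub, b_B_succ, hBb, sub_neg_eq_add, ← perD_succ]
            exact hD (m + 1)
        have := hgb (m + 1) (ω (m + 1) - B R A m (solve g ω m)) (by omega)
          (sub_mem (hωK _) (hB _ _ (hηK m))) (LinearMap.mem_ker.2 hcyc)
        rw [solve, this, sub_add_cancel]

/-- The boundary of a chain `y` of degree `n + 1` has no components of degree less than `n`. -/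
lemma perD_single_of_lt {n m : ℕ} (y : Chain R A (n + 1)) (hm : m < n) :
    perD R A (Pi.single (n + 1) y) m = 0 := by
  rcases m with - | m
  · rw [perD_zero, Pi.single_eq_of_ne (by omega), map_zero]
  · rw [perD_succ, Pi.single_eq_of_ne (by omega), Pi.single_eq_of_ne (by omega), map_zero, map_zero,
      add_zero]

lemma perD_single_self {n : ℕ} (y : Chain R A (n + 1)) :
    perD R A (Pi.single (n + 1) y) n = b R A n y := by
  rcases n with - | n
  · rw [perD_zero, Pi.single_eq_same]
  · rw [perD_succ, Pi.single_eq_same, Pi.single_eq_of_ne (by omega), map_zero, add_zero]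

lemma single_mem_perGraded {n : ℕ} {q : ZMod 2} (hn : (n : ZMod 2) = q) (y : Chain R A n) :
    (Pi.single n y : PerChain R A) ∈ perGraded R A q := fun m hm =>
  Pi.single_eq_of_ne (fun h => hm (by rw [h, hn])) y

lemma perBoundaries_le_perCycles (q : ZMod 2) : perBoundaries R A q ≤ perCycles R A q := by
  rintro _ ⟨η, hη, rfl⟩
  refine ⟨LinearMap.mem_ker.2 (perD_perD η), fun n hn => ?_⟩
  have hq : q + 1 + 1 = q := by
    rw [add_assoc, one_add_one_eq_two, show (2 : ZMod 2) = 0 from rfl, add_zero]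
  rcases n with - | n
  · have h₁ : ((1 : ℕ) : ZMod 2) ≠ q + 1 := fun h => hn <| by
      rw [← hq, ← h]
      rfl
    rw [perD_zero, hη 1 h₁, map_zero]
  · have h₁ : (n : ZMod 2) ≠ q + 1 := fun h => hn <| by rw [Nat.cast_succ, h, hq]
    have h₂ : ((n + 2 : ℕ) : ZMod 2) ≠ q + 1 := fun h => h₁ <| by
      rw [← h, Nat.cast_add, show ((2 : ℕ) : ZMod 2) = 0 from rfl, add_zero]
    rw [perD_succ, hη _ h₁, hη _ h₂, map_zero, map_zero, add_zero]

end Filling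

/-! ### Comparison of the homology of the sum and of the summands -/

section Main

variable {B : Type*} [NonUnitalRing B] [Module ℂ B] [IsScalarTower ℂ B B] [SMulCommClass ℂ B B]

/-- The kernel of the augmentation `(B⁺)^{⊗ (n + 1)} → ℂ^{⊗ (n + 1)}`. -/
def reducedChain (B : Type*) [NonUnitalRing B] [Module ℂ B] [IsScalarTower ℂ B B]
    [SMulCommClass ℂ B B] (n : ℕ) : Submodule ℂ (Chain ℂ (Unitization ℂ B) n) :=
  LinearMap.ker (chainMap (Unitization.fstHom ℂ B) n)

lemma mapChain_mem_reducedChain {A : Type*} [NonUnitalRing A] [Module ℂ A]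
    (E : A →ₗ[ℂ] Unitization ℂ B) (hE : ∀ a, (E a).fst = 0) (n : ℕ) (x : Chain ℂ A n) :
    mapChain E n x ∈ reducedChain B n := by
  have h : (Unitization.fstHom ℂ B).toLinearMap ∘ₗ E = 0 := LinearMap.ext hE
  refine LinearMap.mem_ker.2 ?_
  change mapChain (Unitization.fstHom ℂ B).toLinearMap n (mapChain E n x) = 0
  rw [← mapChain_comp, h, mapChain_zero]

/-- A boundary in the kernel of the augmentation is the boundary of a chain in that kernel, because
the augmentation has a section. -/
lemma exists_reduced_b_eq {n : ℕ} (y : Chain ℂ (Unitization ℂ B) (n + 1))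
    (h : b ℂ (Unitization ℂ B) n y ∈ reducedChain B n) :
    ∃ y' ∈ reducedChain B (n + 1), b ℂ (Unitization ℂ B) n y' = b ℂ (Unitization ℂ B) n y := by
  let ι := Algebra.ofId ℂ (Unitization ℂ B)
  let ε := Unitization.fstHom ℂ B
  have hει : ε.comp ι = AlgHom.id ℂ ℂ := Subsingleton.elim _ _
  refine ⟨y - chainMap ι (n + 1) (chainMap ε (n + 1) y), LinearMap.mem_ker.2 ?_, ?_⟩
  · have h₁ : chainMap ε (n + 1) (chainMap ι (n + 1) (chainMap ε (n + 1) y))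
        = chainMap ε (n + 1) y := by
      rw [← chainMap_comp, hει]
      exact mapChain_id _ _
    rw [map_sub, h₁, sub_self]
  · rw [map_sub, ← chainMap_b, ← chainMap_b, LinearMap.mem_ker.1 h, map_zero, sub_zero]

variable {I : ℕ → NonUnitalSubalgebra ℂ B} (hI : ∀ n, IsTwoSidedIdeal (I n))
  {p : ∀ i, B →ₙₐ[ℂ] I i} (hp : ∀ i (x : I i), p i x = x)
  (hp₀ : ∀ i j, i ≠ j → ∀ x : I j, p i x = 0)
  (hpF : ∀ x, ∃ F : Finset ℕ, x = ∑ i ∈ F, (p i x : B))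
  {e : ℕ → B} (he : ∀ k, IsIdempotentElem (e k))
  (hcorner : ⋃ k, Set.range (fun x : B => e k * x * e k) = Set.univ)

section

include hI hp hpF he hcorner

lemma exists_reduced_eq_b_add_sum {n : ℕ} {x : Chain ℂ (Unitization ℂ B) n}
    (hx : x ∈ hochschildCycles ℂ (Unitization ℂ B) n) (hx' : x ∈ reducedChain B n) :
    ∃ (F : Finset ℕ), ∃ y ∈ reducedChain B (n + 1), ∃ z : ∀ i, Chain ℂ (I i) n,
      (∀ i, z i ∈ hochschildCycles ℂ (I i) n) ∧
        x = b ℂ (Unitization ℂ B) n y + ∑ i ∈ F, mapChain (inclUnitization (I i)) n (z i) := by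
  obtain ⟨F, y, z, hz, hxy⟩ := exists_eq_b_add_sum hI hp hpF he hcorner hx hx'
  obtain ⟨y', hy', h⟩ := exists_reduced_b_eq y <| by
    rw [← sub_eq_iff_eq_add.2 hxy]
    exact sub_mem hx' <| sum_mem fun i _ =>
      mapChain_mem_reducedChain (inclUnitization (I i))
        (fun a => Unitization.fst_inr ℂ (a : B)) n (z i)
  exact ⟨F, y', hy', z, hz, hxy.trans (by rw [h])⟩

/-- Above degree `N` the kernel of the augmentation of `B⁺` is acyclic, since its Hochschild cycles
are homologous to cycles of `B` itself. -/
lemma exists_b_eq_of_subsingleton_HH {N : ℕ} (hN : ∀ q, N < q → Subsingleton (HH ℂ B q)) {n : ℕ}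
    (hn : N < n) {x : Chain ℂ (Unitization ℂ B) n} (hx' : x ∈ reducedChain B n)
    (hx : x ∈ hochschildCycles ℂ (Unitization ℂ B) n) :
    ∃ y ∈ reducedChain B (n + 1), b ℂ (Unitization ℂ B) n y = x := by
  obtain ⟨F, y, hy, z, hz, hxy⟩ := exists_reduced_eq_b_add_sum hI hp hpF he hcorner hx hx'
  let w : Chain ℂ B n := ∑ i ∈ F, mapChain (I i).toSubmodule.subtype n (z i)
  have hw : w ∈ hochschildCycles ℂ B n := sum_mem fun i _ =>
    mapChain_mem_hochschildCycles (S := Set.univ) _ (fun _ _ _ _ => rfl)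
      (mem_spanChain_univ n _) (hz i)
  obtain ⟨v, hv⟩ : w ∈ LinearMap.range (b ℂ B n) := by
    have := hN n hn
    have h : (⟨w, hw⟩ : hochschildCycles ℂ B n) ∈
        (LinearMap.range (b ℂ B n)).submoduleOf (hochschildCycles ℂ B n) :=
      (Submodule.Quotient.mk_eq_zero _).1
        (Subsingleton.elim (Submodule.Quotient.mk ⟨w, hw⟩ : HH ℂ B n) 0)
    exact h
  refine ⟨y + mapChain (Unitization.inrHom ℂ ℂ B) (n + 1) v, add_mem hy
    (mapChain_mem_reducedChain _ (Unitization.fst_inr ℂ) _ _), ?_⟩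
  rw [map_add, b_mapChain (S := Set.univ) _ (fun _ _ _ _ => Unitization.inr_mul ℂ _ _)
    (mem_spanChain_univ _ _), hv, hxy, map_sum]
  exact congrArg _ (Finset.sum_congr rfl fun i _ => (mapChain_comp _ _ n (z i)).symm)

end

/-- The map `⨁ HP_q(Iₙ) → HP_q(B)` induced by the inclusions. -/
def HP.fromSum (I : ℕ → NonUnitalSubalgebra ℂ B) (q : ZMod 2) :
    DirectSum ℕ (fun n => HP ℂ (I n) q) →ₗ[ℂ] HP ℂ B q :=
  DirectSum.toModule ℂ ℕ _ fun n => HP.map (NonUnitalSubalgebraClass.subtype (I n)) q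

include hp hp₀

lemma HP.fromSum_injective (q : ZMod 2) : Function.Injective (HP.fromSum I q) := by
  refine (injective_iff_map_eq_zero _).2 fun x hx => DirectSum.ext_component ℂ fun i => ?_
  have h : HP.map (p i) q ∘ₗ HP.fromSum I q = DirectSum.component ℂ ℕ _ i := by
    refine DirectSum.linearMap_ext ℂ fun j => LinearMap.ext fun y => ?_
    rw [LinearMap.comp_apply, LinearMap.comp_apply, LinearMap.comp_apply, HP.fromSum,
      DirectSum.toModule_lof, ← HP.map_comp]
    by_cases hij : i = j
    · subst hij
      rw [DirectSum.component.lof_self, show (p i).comp (NonUnitalSubalgebraClass.subtype (I i))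
        = NonUnitalAlgHom.id ℂ (I i) from NonUnitalAlgHom.ext (hp i), HP.map_id]
    · rw [DirectSum.component.of, dif_neg (Ne.symm hij),
        show (p i).comp (NonUnitalSubalgebraClass.subtype (I j)) = 0 from
          NonUnitalAlgHom.ext (hp₀ i j hij), HP.map_zero_hom]
  rw [← h, LinearMap.comp_apply, hx, map_zero, map_zero]

/-- The endomorphism of `B⁺` induced by the projection of `B` onto the ideal `I i`. -/
def projUnitization (p : ∀ i, B →ₙₐ[ℂ] I i) (i : ℕ) : Unitization ℂ B →ₐ[ℂ] Unitization ℂ B :=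
  unitizationMap ((NonUnitalSubalgebraClass.subtype (I i)).comp (p i))

lemma chainMap_projUnitization (i j n : ℕ) (z : Chain ℂ (I j) n) :
    chainMap (projUnitization p i) n (mapChain (inclUnitization (I j)) n z)
      = if i = j then mapChain (inclUnitization (I j)) n z else 0 := by
  change mapChain (projUnitization p i).toLinearMap n _ = _
  rw [← mapChain_comp]
  have h : ∀ x : I j, projUnitization p i (inclUnitization (I j) x) = Unitization.inr (p i x : B) :=
    fun x => unitizationMap_inr _ _
  split_ifs with hij
  · subst hij
    refine congrArg (fun E => mapChain E n z) (LinearMap.ext fun x => (h x).trans ?_)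
    rw [hp]
    rfl
  · rw [← mapChain_zero n z]
    refine congrArg (fun E => mapChain E n z) (LinearMap.ext fun x => (h x).trans ?_)
    rw [hp₀ i j hij]
    rfl

include hI hpF he hcorner

/-- Modulo the classes coming from the ideals, each class in `HP_q(B)` is represented by a cycle
without components of degree less than `n`. -/
lemma HP.exists_cycle_vanishing_below (q : ZMod 2) (x : HP ℂ B q) (n : ℕ) :
    ∃ ω : perCycles ℂ (Unitization ℂ B) q, perMap (Unitization.fstHom ℂ B) ω.1 = 0 ∧
      (∀ m < n, ω.1 m = 0) ∧ x - HP.mk q ω ∈ LinearMap.range (HP.fromSum I q) := by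
  induction n with
  | zero =>
    obtain ⟨ω, hω, rfl⟩ := HP.exists_reduced q x
    exact ⟨ω, hω, fun m hm => absurd hm (Nat.not_lt_zero m), by rw [sub_self]; exact zero_mem _⟩
  | succ n ih =>
    obtain ⟨ω, hω, hωn, hωx⟩ := ih
    by_cases hn : (n : ZMod 2) = q
    swap
    · refine ⟨ω, hω, fun m hm => ?_, hωx⟩
      rcases Nat.lt_succ_iff_lt_or_eq.1 hm with hm | rfl
      · exact hωn m hm
      · exact ω.2.2 m hn
    have hcyc : ω.1 n ∈ hochschildCycles ℂ (Unitization ℂ B) n := by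
      have hD := LinearMap.mem_ker.1 ω.2.1
      rcases n with - | - | n
      · exact Submodule.mem_top
      · exact LinearMap.mem_ker.2 (congrFun hD 0)
      · have h := congrFun hD (n + 1)
        rw [perD_succ, hωn n (by omega), map_zero, add_zero] at h
        exact LinearMap.mem_ker.2 h
    obtain ⟨F, y, hy, z, -, hxy⟩ := exists_reduced_eq_b_add_sum hI hp hpF he hcorner hcyc
      (LinearMap.mem_ker.2 (congrFun hω n))
    -- `π i` is the projection onto the ideal `I i`; what is left after removing the projections
    -- for `i ∈ F` is a boundary in degree `n`
    let π := projUnitization p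
    let y' := y - ∑ i ∈ F, chainMap (π i) (n + 1) y
    have hπ : ∀ i, (Unitization.fstHom ℂ B).comp (π i) = Unitization.fstHom ℂ B := fun i =>
      fstHom_comp_unitizationMap _
    have hy' : y' ∈ reducedChain B (n + 1) := by
      refine sub_mem hy (sum_mem fun i _ => LinearMap.mem_ker.2 ?_)
      rw [← chainMap_comp, hπ]
      exact LinearMap.mem_ker.1 hy
    have hωn' : ω.1 n - ∑ i ∈ F, chainMap (π i) n (ω.1 n) = b ℂ (Unitization ℂ B) n y' := by
      have h : ∀ i ∈ F, chainMap (π i) n (ω.1 n)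
          = b ℂ (Unitization ℂ B) n (chainMap (π i) (n + 1) y)
          + mapChain (inclUnitization (I i)) n (z i) := fun i hi => by
        rw [hxy, map_add, chainMap_b, map_sum]
        simp only [π, chainMap_projUnitization hp hp₀]
        rw [Finset.sum_ite_eq, if_pos hi]
      rw [Finset.sum_congr rfl h, Finset.sum_add_distrib, map_sub, map_sum]
      conv_lhs => rw [hxy]
      abel
    let β : perCycles ℂ (Unitization ℂ B) q := ⟨perD ℂ (Unitization ℂ B) (Pi.single (n + 1) y'),
      perBoundaries_le_perCycles q ⟨_, single_mem_perGraded (by rw [Nat.cast_succ, hn]) _, rfl⟩⟩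
    let ρ : ℕ → perCycles ℂ (Unitization ℂ B) q := fun i =>
      ⟨perMap (π i) ω.1, perMap_perCycles _ q _ ω.2⟩
    have hβ : HP.mk q β = 0 := HP.mk_eq_zero_of_mem_perBoundaries
      ⟨_, single_mem_perGraded (by rw [Nat.cast_succ, hn]) _, rfl⟩
    have hcoe : (ω - ∑ i ∈ F, ρ i - β).1 = ω.1 - ∑ i ∈ F, perMap (π i) ω.1
        - perD ℂ (Unitization ℂ B) (Pi.single (n + 1) y') := by
      rw [Submodule.coe_sub, Submodule.coe_sub, Submodule.coe_sum]
    refine ⟨ω - ∑ i ∈ F, ρ i - β, ?_, fun m hm => ?_, ?_⟩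
    · have hsingle : perMap (Unitization.fstHom ℂ B) (Pi.single (n + 1) y') = 0 :=
        funext fun m => by
          change chainMap (Unitization.fstHom ℂ B) m
            ((Pi.single (n + 1) y' : PerChain ℂ (Unitization ℂ B)) m) = 0
          rcases eq_or_ne m (n + 1) with rfl | hm
          · rw [Pi.single_eq_same]
            exact LinearMap.mem_ker.1 hy'
          · rw [Pi.single_eq_of_ne hm, map_zero]
      rw [hcoe, map_sub, map_sub, hω, map_sum, perMap_perD, hsingle, map_zero, sub_zero, zero_sub,
        neg_eq_zero]
      exact Finset.sum_eq_zero fun i _ => by rw [← perMap_comp, hπ, hω]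
    · rw [hcoe]
      change ω.1 m - (∑ i ∈ F, perMap (π i) ω.1) m - _ = 0
      rw [Finset.sum_apply]
      change ω.1 m - ∑ i ∈ F, chainMap (π i) m (ω.1 m) - _ = 0
      rcases Nat.lt_succ_iff_lt_or_eq.1 hm with hm | rfl
      · rw [hωn m hm, perD_single_of_lt _ hm]
        simp
      · rw [hωn', perD_single_self, sub_self]
    · have hρ : ∀ i, HP.mk q (ρ i) ∈ LinearMap.range (HP.fromSum I q) := fun i => by
        refine ⟨DirectSum.lof ℂ ℕ _ i (HP.map (p i) q (HP.mk q ω)), ?_⟩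
        rw [HP.fromSum, DirectSum.toModule_lof, ← HP.map_comp]
        exact HP.map_mk _ q ω
      rw [map_sub, map_sub, map_sum, hβ, sub_zero, ← sub_add]
      exact add_mem hωx (sum_mem fun i _ => hρ i)

lemma HP.fromSum_surjective {N : ℕ} (hN : ∀ q, N < q → Subsingleton (HH ℂ B q)) (q : ZMod 2) :
    Function.Surjective (HP.fromSum I q) := by
  intro x
  obtain ⟨ω, hω, hωN, hωx⟩ :=
    HP.exists_cycle_vanishing_below hI hp hp₀ hpF he hcorner q x (N + 1)
  have h : ω.1 ∈ perBoundaries ℂ (Unitization ℂ B) q :=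
    mem_perBoundaries_of_acyclic (reducedChain B)
      (fun n x hx => LinearMap.mem_ker.2 (by rw [chainMap_B, LinearMap.mem_ker.1 hx, map_zero]))
      (fun n hn x hx hx' => exists_b_eq_of_subsingleton_HH hI hp hpF he hcorner hN hn hx hx')
      ω.2 (fun n => LinearMap.mem_ker.2 (congrFun hω n)) fun n hn => hωN n (Nat.lt_succ_of_le hn)
  rw [HP.mk_eq_zero_of_mem_perBoundaries h, sub_zero] at hωx
  exact hωx

end Main

end CyclicHomology

end

theorem mainTheorem5 {B : Type*} [NonUnitalRing B] [Module ℂ B] [IsScalarTower ℂ B B]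
    [SMulCommClass ℂ B B]
    (I : ℕ → NonUnitalSubalgebra ℂ B)
    (hI : ∀ n, CyclicHomology.IsTwoSidedIdeal (I n))
    (hsum : DirectSum.IsInternal fun n => (I n).toSubmodule)
    (e : ℕ → B) (he : ∀ k, IsIdempotentElem (e k))
    (hcorner : ⋃ k, Set.range (fun x : B => e k * x * e k) = Set.univ)
    (N : ℕ) (hN : ∀ q, N < q → Subsingleton (CyclicHomology.HH ℂ B q))
    (q : ZMod 2) :
    ∃ φ : DirectSum ℕ (fun n => CyclicHomology.HP ℂ (I n) q) ≃ₗ[ℂ] CyclicHomology.HP ℂ B q,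
      ∀ (n : ℕ) (x : CyclicHomology.HP ℂ (I n) q),
        φ (DirectSum.lof ℂ ℕ (fun n => CyclicHomology.HP ℂ (I n) q) n x)
          = CyclicHomology.HP.map (NonUnitalSubalgebraClass.subtype (I n)) q x := by
  obtain ⟨p, hp, hp₀, hpF⟩ := CyclicHomology.exists_projections hI hsum
  refine ⟨LinearEquiv.ofBijective (CyclicHomology.HP.fromSum I q)
    ⟨CyclicHomology.HP.fromSum_injective hp hp₀ q,
      CyclicHomology.HP.fromSum_surjective hI hp hp₀ hpF he hcorner hN q⟩, fun n x => ?_⟩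
  exact DirectSum.toModule_lof ℂ (M := fun n => CyclicHomology.HP ℂ (I n) q) n x
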